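/- Let $\mathcal S,\mathcal T,\mathcal R$ be operator systems (complex $*$-vector spaces with a matrix ordering by proper cones $M_n(\cdot)^+$ of hermitian matrices satisfying $\alpha M_n(\cdot)^+\alpha^*\subseteq M_m(\cdot)^+$ for every scalar $m\times n$ matrix $\alpha$, and an Archimedean matrix order unit $1$), let $\phi:\mathcal S\times\mathcal T\to\mathcal R$ be a bilinear map with linearization $\tilde\phi:\mathcal S\otimes\mathcal T\to\mathcal R$, $\tilde\phi(x\otimes y)=\phi(x,y)$, and let $p,q,r\ge 1$ be integers. The map $\phi$ is called $(p,q,r)$-positive if $$\alpha\,[\phi(x_{i,j},y_{k,\ell})]_{(i,k),(j,\ell)}\,\alpha^*\in M_r(\mathcal R)^+$$ for all $x=[x_{i,j}]\in M_p(\mathcal S)^+$, $y=[y_{k,\ell}]\in M_q(\mathcal T)^+$ and every $r\times pq$ complex matrix $\alpha$. For an operator system $\mathcal S$ and an integer $k\ge1$, let $\mathrm{OMAX}^k(\mathcal S)$ be the operator system with the same underlying $*$-vector space and unit as $\mathcal S$ whose cone at level $n$ consists of all $x\in M_n(\mathcal S)$ such that, for every $\varepsilon>0$, the matrix $x+\varepsilon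 I_n\otimes 1_{\mathcal S}$ is of the form $\alpha\,\mathrm{diag}(s_1,\dots,s_m)\,\alpha^*$ with $m\in\mathbb N$, $s_i\in M_k(\mathcal S)^+$ and $\alpha$ an $n\times mk$ complex matrix. Let $\mathrm{OMIN}^k(\mathcal S)$ be the operator system with the same underlying $*$-vector space and unit whose cone at level $n$ consists of all $[s_{i,j}]\in M_n(\mathcal S)$ such that $[\varphi(s_{i,j})]\ge 0$ for every unital completely positive map $\varphi:\mathcal S\to M_k(\mathbb C)$. Let $\mathcal S\otimes_{\max}\mathcal T$ be the operator system on $\mathcal S\otimes\mathcal T$ with unit $1_{\mathcal S}\otimes 1_{\mathcal T}$ whose cone at level $n$ consists of all $z$ such that, for every $\varepsilon>0$, $z+\varepsilon I_n\otimes 1_{\mathcal S}\otimes 1_{\mathcal T}$ is of the form $\alpha(P\otimes Q)\alpha^*$ with $P\in M_k(\mathcal S)^+$, $Q\in M_\ell(\mathcal T)^+$, $k,\ell\in\mathbb N$ and $\alpha$ an $n\times k\ell$ complex matrix. Then the following are equivalent: 1. $\phi$ is $(p,q,r)$-positive; 2. $\tilde\phi:\mathrm{OMAX}^p(\mathcal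 S)\otimes_{\max}\mathrm{OMAX}^q(\mathcal T)\to\mathcal R$ is $r$-positive, that is, $[\tilde\phi(z_{i,j})]\in M_r(\mathcal R)^+$ for every $[z_{i,j}]\in M_r(\mathrm{OMAX}^p(\mathcal S)\otimes_{\max}\mathrm{OMAX}^q(\mathcal T))^+$; 3. $\tilde\phi:\mathrm{OMAX}^p(\mathcal S)\otimes_{\max}\mathrm{OMAX}^q(\mathcal T)\to\mathrm{OMIN}^r(\mathcal R)$ is completely positive, that is, $k$-positive for every $k$. -/

import Mathlib

open scoped TensorProduct Matrix ComplexOrder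

noncomputable section

namespace OpSys

set_option linter.unusedSectionVars false
set_option linter.unusedSimpArgs false

section Matrices

variable {V W : Type*} [AddCommGroup V] [Module ℂ V] [AddCommGroup W] [Module ℂ W]

/-- The matrix `α x α*` over `V`, for a scalar matrix `α` and a square matrix `x` over `V`. -/
def congrBy {m n : Type*} [Fintype n] (α : Matrix m n ℂ) (x : Matrix n n V) : Matrix m m V :=
  Matrix.of fun i j => ∑ k, ∑ l, (α i k * star (α j l)) • x k l

/-- The matrix `I_n ⊗ e` over `V`. -/
def unitMatrix (n : ℕ) (e : V) : Matrix (Fin n) (Fin n) V :=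
  Matrix.diagonal fun _ => e

/-- An element of `V` as a `1 × 1` matrix. -/
def mat1 (v : V) : Matrix (Fin 1) (Fin 1) V := Matrix.of fun _ _ => v

theorem congrBy_add {m n : Type*} [Fintype n] (α : Matrix m n ℂ) (x y : Matrix n n V) :
    congrBy α (x + y) = congrBy α x + congrBy α y := by
  ext i j; simp [congrBy, Finset.sum_add_distrib]

theorem congrBy_smul {m n : Type*} [Fintype n] (α : Matrix m n ℂ) (c : ℂ) (x : Matrix n n V) :
    congrBy α (c • x) = c • congrBy α x := by
  ext i j; simp [congrBy, Finset.smul_sum, smul_comm c]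

theorem congrBy_sub {m n : Type*} [Fintype n] (α : Matrix m n ℂ) (x y : Matrix n n V) :
    congrBy α (x - y) = congrBy α x - congrBy α y := by
  ext i j; simp [congrBy, smul_sub]

theorem congrBy_zero {m n : Type*} [Fintype n] (α : Matrix m n ℂ) :
    congrBy α (0 : Matrix n n V) = 0 := by
  ext i j; simp [congrBy]

theorem congrBy_sum {m n ι : Type*} [Fintype n] (s : Finset ι) (α : Matrix m n ℂ)
    (x : ι → Matrix n n V) : congrBy α (∑ i ∈ s, x i) = ∑ i ∈ s, congrBy α (x i) := by
  classical
  induction s using Finset.induction_on with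
  | empty => simp [congrBy_zero]
  | insert a s ha ih => rw [Finset.sum_insert ha, Finset.sum_insert ha, congrBy_add, ih]

theorem congrBy_congrBy {l m n : Type*} [Fintype m] [Fintype n] (β : Matrix l m ℂ)
    (α : Matrix m n ℂ) (x : Matrix n n V) :
    congrBy β (congrBy α x) = congrBy (β * α) x := by
  ext i j
  simp only [congrBy, Matrix.of_apply, Matrix.mul_apply, Finset.smul_sum, smul_smul, star_sum,
    Finset.sum_mul_sum, Finset.sum_smul]
  calc _ = ∑ a, ∑ b, ∑ k, ∑ l, (β i a * star (β j b) * (α a k * star (α b l))) • x k l := rfl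
    _ = ∑ a, ∑ k, ∑ b, ∑ l, (β i a * star (β j b) * (α a k * star (α b l))) • x k l :=
        Finset.sum_congr rfl fun a _ => Finset.sum_comm
    _ = ∑ k, ∑ a, ∑ b, ∑ l, (β i a * star (β j b) * (α a k * star (α b l))) • x k l :=
        Finset.sum_comm
    _ = ∑ k, ∑ a, ∑ l, ∑ b, (β i a * star (β j b) * (α a k * star (α b l))) • x k l :=
        Finset.sum_congr rfl fun k _ => Finset.sum_congr rfl fun a _ => Finset.sum_comm
    _ = ∑ k, ∑ l, ∑ a, ∑ b, (β i a * star (β j b) * (α a k * star (α b l))) • x k l :=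
        Finset.sum_congr rfl fun k _ => Finset.sum_comm
    _ = _ := by
        refine Finset.sum_congr rfl fun k _ => Finset.sum_congr rfl fun l _ =>
          Finset.sum_congr rfl fun a _ => Finset.sum_congr rfl fun b _ => ?_
        congr 1
        simp only [star_mul']
        ring

theorem congrBy_map {m n : Type*} [Fintype n] (f : V →ₗ[ℂ] W) (α : Matrix m n ℂ)
    (x : Matrix n n V) : (congrBy α x).map f = congrBy α (x.map f) := by
  ext i j; simp [congrBy, map_sum]

theorem congrBy_eq_mul {m n : Type*} [Fintype n] (α : Matrix m n ℂ) (x : Matrix n n ℂ) :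
    congrBy α x = α * x * αᴴ := by
  ext i j
  simp only [congrBy, Matrix.of_apply, Matrix.mul_apply, Matrix.conjTranspose_apply,
    Finset.sum_mul, smul_eq_mul]
  rw [Finset.sum_comm]
  refine Finset.sum_congr rfl fun k _ => Finset.sum_congr rfl fun l _ => by ring

theorem congrBy_unitMatrix {m : Type*} {n : ℕ} (α : Matrix m (Fin n) ℂ) (e : V) :
    congrBy α (unitMatrix n e) = (α * αᴴ).map fun c => c • e := by
  ext i j
  simp [congrBy, unitMatrix, Matrix.diagonal_apply, Matrix.mul_apply, Finset.sum_smul]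

theorem unitMatrix_eq_sum (n : ℕ) (e : V) :
    unitMatrix n e = ∑ i : Fin n,
      congrBy (Matrix.of fun a (_ : Fin 1) => (Pi.single i 1 : Fin n → ℂ) a) (mat1 e) := by
  ext a b
  simp only [unitMatrix, Matrix.diagonal_apply, Matrix.sum_apply, congrBy, mat1, Matrix.of_apply,
    Finset.univ_unique, Finset.sum_singleton, Pi.single_apply]
  by_cases h : a = b
  · subst h; simp [ite_smul]
  · have : ∀ i : Fin n, ¬ (a = i ∧ b = i) := by rintro i ⟨rfl, rfl⟩; exact h rfl
    rw [if_neg h, eq_comm]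
    refine Finset.sum_eq_zero fun i _ => ?_
    by_cases h1 : a = i <;> by_cases h2 : b = i <;> simp [h1, h2]
    exact absurd ⟨h1, h2⟩ (this i)

theorem congrBy_blockDiagonal {m k o : Type*} [Fintype k] [Fintype o] [DecidableEq o]
    (α : Matrix m (k × o) ℂ) (s : o → Matrix k k V) :
    congrBy α (Matrix.blockDiagonal s) =
      ∑ i, congrBy (Matrix.of fun a b => α a (b, i)) (s i) := by
  ext a b
  simp only [congrBy, Matrix.of_apply, Matrix.sum_apply, Fintype.sum_prod_type,
    Matrix.blockDiagonal_apply, smul_ite, smul_zero]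
  rw [Finset.sum_comm]
  simp

variable [StarAddMonoid V] [StarModule ℂ V]

theorem conjTranspose_congrBy {m n : Type*} [Fintype n] (α : Matrix m n ℂ) (x : Matrix n n V) :
    (congrBy α x)ᴴ = congrBy α xᴴ := by
  ext i j
  simp only [congrBy, Matrix.conjTranspose_apply, Matrix.of_apply, star_sum, star_smul, star_mul',
    star_star]
  rw [Finset.sum_comm]
  refine Finset.sum_congr rfl fun k _ => Finset.sum_congr rfl fun l _ => by rw [mul_comm]

theorem isHermitian_congrBy {m n : Type*} [Fintype n] (α : Matrix m n ℂ) {x : Matrix n n V}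
    (hx : x.IsHermitian) : (congrBy α x).IsHermitian := by
  rw [Matrix.IsHermitian, conjTranspose_congrBy, hx]

theorem isHermitian_unitMatrix (n : ℕ) {e : V} (he : star e = e) :
    (unitMatrix n e).IsHermitian := by
  rw [Matrix.IsHermitian, unitMatrix, Matrix.diagonal_conjTranspose]
  congr 1
  funext i
  simp [he]

theorem isHermitian_real_smul {n : Type*} (r : ℝ) {x : Matrix n n V} (hx : x.IsHermitian) :
    ((r : ℂ) • x).IsHermitian := by
  rw [Matrix.IsHermitian, Matrix.conjTranspose_smul, hx]
  simp

theorem isHermitian_mat1 {v : V} (hv : star v = v) : (mat1 v).IsHermitian := by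
  ext i j; simp [mat1, hv]

/-- Polarization: `E_{ij} ⊗ v + E_{ji} ⊗ v*` is a sum of matrices `u u* ⊗ h` with `h = h*`. -/
theorem single_add_conjTranspose {n : ℕ} (i j : Fin n) (v : V) :
    Matrix.single i j v + (Matrix.single i j v)ᴴ =
      ∑ m : Fin 4, congrBy
        (Matrix.of fun a (_ : Fin 1) =>
          (Pi.single i 1 + (Complex.I ^ (m : ℕ)) • Pi.single j 1 : Fin n → ℂ) a)
        (mat1 ((1 / 4 : ℂ) • (Complex.I ^ (m : ℕ) • v + star (Complex.I ^ (m : ℕ) • v)))) := by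
  ext a b
  have hs : ∀ a b : Fin n, Matrix.single i j v a b =
      ((if a = i then 1 else 0 : ℂ) * (if b = j then 1 else 0 : ℂ)) • v := by
    intro a b
    by_cases h1 : i = a <;> by_cases h2 : j = b <;> simp [h1, h2, eq_comm]
  rw [Matrix.add_apply, Matrix.conjTranspose_apply, hs, hs]
  simp only [Matrix.sum_apply, congrBy, mat1, Matrix.of_apply, Finset.univ_unique,
    Finset.sum_singleton, Fin.sum_univ_four, Pi.add_apply, Pi.smul_apply, Pi.single_apply]
  have hp : ∀ c d : Fin n, star (if c = d then 1 else 0 : ℂ) = if c = d then 1 else 0 := by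
    intro c d; split_ifs <;> simp
  have h3 : Complex.I ^ 3 = -Complex.I := by
    rw [pow_succ, Complex.I_sq]; ring
  have hI : star Complex.I = -Complex.I := Complex.conj_I
  have hI2 : Complex.I * Complex.I = -1 := Complex.I_mul_I
  simp only [star_smul, star_mul', star_add, hp, smul_eq_mul, hI]
  generalize (if a = i then 1 else 0 : ℂ) = p
  generalize (if a = j then 1 else 0 : ℂ) = q
  generalize (if b = i then 1 else 0 : ℂ) = s
  generalize (if b = j then 1 else 0 : ℂ) = t
  simp only [Fin.val_zero, Fin.val_one, Fin.val_two, show ((3 : Fin 4) : ℕ) = 3 from rfl, pow_zero,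
    pow_one, Complex.I_sq, h3, star_neg, star_one, hI]
  match_scalars
  · linear_combination (p * t / 2 - q * s / 2) * hI2
  · linear_combination (q * s / 2 - p * t / 2) * hI2

end Matrices
section Orderings

variable {V W : Type*} [AddCommGroup V] [Module ℂ V] [StarAddMonoid V] [StarModule ℂ V]
  [AddCommGroup W] [Module ℂ W] [StarAddMonoid W] [StarModule ℂ W]

variable (V) in
/-- A matrix ordering on the `*`-vector space `V`: cones `pos n` of hermitian matrices in `M_n(V)`
with `α (pos n) α* ⊆ pos m` for all scalar `m × n` matrices `α`. (Closure under multiplication by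
`t ≥ 0` is the case `α = √t I`.) -/
structure MatrixOrdering where
  pos : ∀ n : ℕ, Set (Matrix (Fin n) (Fin n) V)
  isHermitian : ∀ {n : ℕ} {x : Matrix (Fin n) (Fin n) V}, x ∈ pos n → x.IsHermitian
  zero_mem : ∀ n : ℕ, (0 : Matrix (Fin n) (Fin n) V) ∈ pos n
  add_mem : ∀ {n : ℕ} {x y : Matrix (Fin n) (Fin n) V}, x ∈ pos n → y ∈ pos n → x + y ∈ pos n
  congr_mem : ∀ {m n : ℕ} (α : Matrix (Fin m) (Fin n) ℂ) {x : Matrix (Fin n) (Fin n) V},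
    x ∈ pos n → congrBy α x ∈ pos m

variable (V) in
/-- An (abstract) operator system on the `*`-vector space `V`: a matrix ordering with proper cones
and an Archimedean matrix order unit `one`. The set `pos n` is the cone `M_n(V)^+`. -/
structure OperatorSystem extends MatrixOrdering V where
  one : V
  star_one : star one = one
  proper : ∀ {n : ℕ} {x : Matrix (Fin n) (Fin n) V}, x ∈ pos n → -x ∈ pos n → x = 0
  orderUnit : ∀ {n : ℕ} {x : Matrix (Fin n) (Fin n) V}, x.IsHermitian →
    ∃ r : ℝ, 0 < r ∧ (r : ℂ) • unitMatrix n one - x ∈ pos n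
  archimedean : ∀ {n : ℕ} {x : Matrix (Fin n) (Fin n) V},
    (∀ ε : ℝ, 0 < ε → (ε : ℂ) • unitMatrix n one + x ∈ pos n) → x ∈ pos n

namespace MatrixOrdering

variable (D : MatrixOrdering V)

theorem smul_mem {n : ℕ} {x : Matrix (Fin n) (Fin n) V} (hx : x ∈ D.pos n) {t : ℝ} (ht : 0 ≤ t) :
    (t : ℂ) • x ∈ D.pos n := by
  have h := D.congr_mem (((Real.sqrt t : ℝ) : ℂ) • (1 : Matrix (Fin n) (Fin n) ℂ)) hx
  convert h using 1
  have h2 : ((Real.sqrt t : ℝ) : ℂ) * ((Real.sqrt t : ℝ) : ℂ) = (t : ℂ) := by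
    rw [← Complex.ofReal_mul, Real.mul_self_sqrt ht]
  have h3 : congrBy (1 : Matrix (Fin n) (Fin n) ℂ) x = x := by
    ext i j; simp [congrBy, Matrix.one_apply, apply_ite (starRingEnd ℂ)]
  have h4 : congrBy (((Real.sqrt t : ℝ) : ℂ) • (1 : Matrix (Fin n) (Fin n) ℂ)) x =
      (t : ℂ) • congrBy (1 : Matrix (Fin n) (Fin n) ℂ) x := by
    ext i j
    simp only [congrBy, Matrix.smul_apply, Matrix.of_apply, Finset.smul_sum, smul_smul,
      smul_eq_mul, star_mul']
    refine Finset.sum_congr rfl fun k _ => Finset.sum_congr rfl fun l _ => ?_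
    congr 1
    rw [← h2, Complex.star_def, Complex.conj_ofReal]
    ring
  rw [h4, h3]

theorem sum_mem {n : ℕ} {ι : Type*} (s : Finset ι) {x : ι → Matrix (Fin n) (Fin n) V}
    (hx : ∀ i ∈ s, x i ∈ D.pos n) : ∑ i ∈ s, x i ∈ D.pos n := by
  classical
  induction s using Finset.induction_on with
  | empty => simpa using D.zero_mem n
  | insert a s ha ih =>
    rw [Finset.sum_insert ha]
    exact D.add_mem (hx a (by simp)) (ih fun i hi => hx i (by simp [hi]))

theorem exists_posSemidef {n : ℕ} (u : Matrix (Fin n) (Fin 1) ℂ) :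
    ∃ r : ℝ, 0 < r ∧ ∃ β : Matrix (Fin n) (Fin n) ℂ,
      (r : ℂ) • (1 : Matrix (Fin n) (Fin n) ℂ) - u * uᴴ = β * βᴴ := by
  by_cases hu : u = 0
  · exact ⟨1, one_pos, 1, by simp [hu]⟩
  set s : ℝ := ∑ i, Complex.normSq (u i 0) with hs
  have hs0 : 0 < s := by
    obtain ⟨i, hi⟩ : ∃ i, u i 0 ≠ 0 := by
      by_contra! h
      exact hu (by ext i j; rw [Subsingleton.elim j 0]; simpa using h i)
    exact Finset.sum_pos' (fun i _ => Complex.normSq_nonneg _)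
      ⟨i, Finset.mem_univ _, Complex.normSq_pos.2 hi⟩
  have huu : uᴴ * u = (s : ℂ) • (1 : Matrix (Fin 1) (Fin 1) ℂ) := by
    ext i j
    rw [Subsingleton.elim i 0, Subsingleton.elim j 0]
    simp [Matrix.mul_apply, hs, Complex.normSq_eq_conj_mul_self]
  have hsq : ((Real.sqrt s : ℝ) : ℂ)⁻¹ * ((Real.sqrt s : ℝ) : ℂ)⁻¹ = (s : ℂ)⁻¹ := by
    rw [← mul_inv, ← Complex.ofReal_mul, Real.mul_self_sqrt hs0.le]
  refine ⟨s, hs0, ((Real.sqrt s : ℝ) : ℂ)⁻¹ •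
    ((s : ℂ) • (1 : Matrix (Fin n) (Fin n) ℂ) - u * uᴴ), ?_⟩
  have h1 : (u * uᴴ) * (u * uᴴ) = (s : ℂ) • (u * uᴴ) := by
    rw [Matrix.mul_assoc, ← Matrix.mul_assoc uᴴ, huu]
    simp
  have hs1 : (s : ℂ) ≠ 0 := by exact_mod_cast hs0.ne'
  rw [Matrix.conjTranspose_smul, Matrix.smul_mul, Matrix.mul_smul, smul_smul, star_inv₀,
    Complex.star_def, Complex.conj_ofReal, hsq, Matrix.conjTranspose_sub,
    Matrix.conjTranspose_smul, Matrix.conjTranspose_one, Matrix.conjTranspose_mul,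
    Matrix.conjTranspose_conjTranspose, Complex.star_def, Complex.conj_ofReal, Matrix.sub_mul,
    Matrix.mul_sub, Matrix.mul_sub, h1]
  simp only [Matrix.smul_mul, Matrix.mul_smul, Matrix.one_mul, Matrix.mul_one, smul_sub, smul_smul]
  match_scalars <;> (field_simp)
  ring

/-- An order unit at the first level is a matrix order unit. -/
theorem orderUnit_of_one {e : V} (hu : ∀ v : V, star v = v →
      ∃ r : ℝ, 0 < r ∧ (r : ℂ) • mat1 e - mat1 v ∈ D.pos 1)
    {n : ℕ} {x : Matrix (Fin n) (Fin n) V} (hx : x.IsHermitian) :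
    ∃ r : ℝ, 0 < r ∧ (r : ℂ) • unitMatrix n e - x ∈ D.pos n := by
  have he1 : mat1 e ∈ D.pos 1 := by
    obtain ⟨r, hr, h⟩ := hu 0 (star_zero V)
    have h0 : mat1 (0 : V) = 0 := rfl
    rw [h0, sub_zero] at h
    have := D.smul_mem h (inv_nonneg.2 hr.le)
    rwa [smul_smul, ← Complex.ofReal_mul, inv_mul_cancel₀ hr.ne', Complex.ofReal_one, one_smul]
      at this
  have hen : unitMatrix n e ∈ D.pos n := by
    rw [unitMatrix_eq_sum]
    exact D.sum_mem _ fun i _ => D.congr_mem _ he1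
  let P : Matrix (Fin n) (Fin n) V → Prop := fun x =>
    ∃ r : ℝ, 0 < r ∧ (r : ℂ) • unitMatrix n e - x ∈ D.pos n
  have hP0 : P 0 := ⟨1, one_pos, by simpa using hen⟩
  have hPadd : ∀ x y, P x → P y → P (x + y) := by
    rintro x y ⟨r, hr, h⟩ ⟨s, hs, h'⟩
    refine ⟨r + s, add_pos hr hs, ?_⟩
    convert D.add_mem h h' using 1
    push_cast
    module
  have hPsum : ∀ (f : Fin 4 → Matrix (Fin n) (Fin n) V), (∀ i, P (f i)) → P (∑ i, f i) := by
    intro f hf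
    rw [Fin.sum_univ_four]
    exact hPadd _ _ (hPadd _ _ (hPadd _ _ (hf 0) (hf 1)) (hf 2)) (hf 3)
  have hPone : ∀ (u : Matrix (Fin n) (Fin 1) ℂ) (h : V), star h = h → P (congrBy u (mat1 h)) := by
    intro u h hh
    obtain ⟨r, hr, h1⟩ := hu h hh
    obtain ⟨s, hs, β, hβ⟩ := exists_posSemidef u
    refine ⟨r * s, mul_pos hr hs, ?_⟩
    have h2 := D.add_mem (D.congr_mem u h1) (D.smul_mem (D.congr_mem β hen) hr.le)
    convert h2 using 1
    have h3 : mat1 e = unitMatrix 1 e := by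
      ext i j; simp [mat1, unitMatrix, Subsingleton.elim i j]
    rw [congrBy_sub, congrBy_smul, congrBy_unitMatrix, ← hβ, h3, congrBy_unitMatrix]
    ext i j
    by_cases hij : i = j
    · subst hij
      simp [unitMatrix, sub_smul, smul_sub, mul_smul]
    · simp [unitMatrix, hij, sub_smul, smul_sub]
      abel
  have hQ : ∀ x : Matrix (Fin n) (Fin n) V, P (x + xᴴ) := by
    intro x
    induction x using Matrix.induction_on' with
    | h_zero => simpa using hP0
    | h_add p q hp hq =>
      convert hPadd _ _ hp hq using 1
      rw [Matrix.conjTranspose_add]; abel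
    | h_std_basis i j v =>
      rw [single_add_conjTranspose]
      refine hPsum _ fun m => hPone _ _ ?_
      simp only [star_smul, star_add, star_star]
      rw [add_comm]
      congr 1
      simp
  obtain ⟨r, hr, h⟩ := hQ x
  rw [hx] at h
  refine ⟨r / 2, by positivity, ?_⟩
  convert D.smul_mem h (t := 1 / 2) (by norm_num) using 1
  push_cast
  module

/-- The Archimedeanization of the matrix ordering `D` with matrix order unit `e`: the cones are
`{x | ε I_n ⊗ e + x ∈ D_n for all ε > 0}`. -/
def archimedeanization (e : V) (he : star e = e)
    (hu : ∀ {n : ℕ} {x : Matrix (Fin n) (Fin n) V}, x.IsHermitian →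
      ∃ r : ℝ, 0 < r ∧ (r : ℂ) • unitMatrix n e - x ∈ D.pos n)
    (hp : ∀ {n : ℕ} {x : Matrix (Fin n) (Fin n) V},
      (∀ ε : ℝ, 0 < ε → (ε : ℂ) • unitMatrix n e + x ∈ D.pos n) →
      (∀ ε : ℝ, 0 < ε → (ε : ℂ) • unitMatrix n e + -x ∈ D.pos n) → x = 0) :
    OperatorSystem V where
  pos n := {x | ∀ ε : ℝ, 0 < ε → (ε : ℂ) • unitMatrix n e + x ∈ D.pos n}
  isHermitian {n x} hx := by
    have h := D.isHermitian (hx 1 one_pos)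
    have h2 := h.sub (isHermitian_real_smul 1 (isHermitian_unitMatrix n he))
    simpa using h2
  zero_mem n ε hε := by
    obtain ⟨r, hr, h⟩ := hu (Matrix.isHermitian_zero (n := Fin n) (α := V))
    convert D.smul_mem h (t := ε / r) (by positivity) using 1
    rw [add_zero, sub_zero, smul_smul, ← Complex.ofReal_mul, div_mul_cancel₀ _ hr.ne']
  add_mem {n x y} hx hy ε hε := by
    convert D.add_mem (hx (ε / 2) (by positivity)) (hy (ε / 2) (by positivity)) using 1
    push_cast
    module
  congr_mem {m n} α {x} hx ε hε := by
    obtain ⟨r, hr, h⟩ := hu (isHermitian_congrBy α (isHermitian_unitMatrix n he))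
    have hd : 0 < ε / r := by positivity
    convert D.add_mem (D.smul_mem h hd.le) (D.congr_mem α (hx _ hd)) using 1
    rw [congrBy_add, congrBy_smul, smul_sub, smul_smul, ← Complex.ofReal_mul,
      div_mul_cancel₀ _ hr.ne']
    abel
  one := e
  star_one := he
  proper hx hx' := hp hx hx'
  orderUnit {n x} hx := by
    obtain ⟨r, hr, h⟩ := hu hx
    obtain ⟨s, hs, h'⟩ := hu (Matrix.isHermitian_zero (n := Fin n) (α := V))
    refine ⟨r, hr, fun ε hε => ?_⟩
    convert D.add_mem (D.smul_mem h' (t := ε / s) (by positivity)) h using 1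
    rw [sub_zero, smul_smul, ← Complex.ofReal_mul, div_mul_cancel₀ _ hs.ne']
  archimedean {n x} hx ε hε := by
    convert hx (ε / 2) (by positivity) (ε / 2) (by positivity) using 1
    push_cast
    module

end MatrixOrdering

end Orderings
section States

variable {V W : Type*} [AddCommGroup V] [Module ℂ V] [StarAddMonoid V] [StarModule ℂ V]
  [AddCommGroup W] [Module ℂ W] [StarAddMonoid W] [StarModule ℂ W]

theorem unitMatrix_one (e : V) : unitMatrix 1 e = mat1 e := by
  ext i j; simp [mat1, unitMatrix, Subsingleton.elim i j]

namespace OperatorSystem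

variable (S : OperatorSystem V)

/-- A state: a unital positive linear functional. -/
def IsState (f : V →ₗ[ℂ] ℂ) : Prop :=
  f S.one = 1 ∧ ∀ v : V, mat1 v ∈ S.pos 1 → 0 ≤ f v

theorem one_mem_one : mat1 S.one ∈ S.pos 1 := by
  obtain ⟨r, hr, h⟩ := S.orderUnit (Matrix.isHermitian_zero (n := Fin 1) (α := V))
  rw [sub_zero, unitMatrix_one] at h
  have := S.smul_mem h (inv_nonneg.2 hr.le)
  rwa [smul_smul, ← Complex.ofReal_mul, inv_mul_cancel₀ hr.ne', Complex.ofReal_one, one_smul]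
    at this

theorem unitMatrix_mem (n : ℕ) : unitMatrix n S.one ∈ S.pos n := by
  rw [unitMatrix_eq_sum]
  exact S.sum_mem _ fun i _ => S.congr_mem _ S.one_mem_one

theorem exists_state_neg {a : V} (ha : star a = a) (h : mat1 a ∉ S.pos 1) :
    ∃ f : V →ₗ[ℂ] ℂ, S.IsState f ∧ f a < 0 := by
  obtain ⟨ε, hε, hn⟩ : ∃ ε : ℝ, 0 < ε ∧ mat1 ((ε : ℂ) • S.one + a) ∉ S.pos 1 := by
    by_contra! hc
    refine h (S.archimedean fun ε hε => ?_)
    rw [unitMatrix_one]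
    exact hc ε hε
  let e : selfAdjoint V := ⟨S.one, S.star_one⟩
  let b : selfAdjoint V := ⟨(ε : ℂ) • S.one + a, by
    rw [selfAdjoint.mem_iff]; simp [ha, S.star_one]⟩
  have hsm : ∀ (t : ℝ) (v : selfAdjoint V), ((t • v : selfAdjoint V) : V) = (t : ℂ) • (v : V) :=
    fun t v => by simp
  have mat1_add : ∀ v w : V, mat1 (v + w) = mat1 v + mat1 w := fun v w => rfl
  have mat1_smul : ∀ (c : ℂ) (v : V), mat1 (c • v) = c • mat1 v := fun v w => rfl
  let C : PointedCone ℝ (selfAdjoint V) :=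
    { carrier := {v | ∃ c : selfAdjoint V, mat1 (c : V) ∈ S.pos 1 ∧ ∃ t : ℝ, 0 ≤ t ∧ v = c - t • b}
      add_mem' := by
        rintro _ _ ⟨c, hc, t, ht, rfl⟩ ⟨c', hc', t', ht', rfl⟩
        refine ⟨c + c', ?_, t + t', add_nonneg ht ht', by module⟩
        rw [AddSubgroup.coe_add, mat1_add]
        exact S.add_mem hc hc'
      zero_mem' := ⟨0, S.zero_mem 1, 0, le_rfl, by simp⟩
      smul_mem' := by
        rintro ⟨s, hs⟩ _ ⟨c, hc, t, ht, rfl⟩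
        refine ⟨s • c, ?_, s * t, mul_nonneg hs ht, ?_⟩
        · rw [hsm, mat1_smul]
          exact S.smul_mem hc hs
        · change s • (c - t • b) = _
          module }
  have hC : ∀ c : selfAdjoint V, mat1 (c : V) ∈ S.pos 1 → c ∈ C :=
    fun c hc => ⟨c, hc, 0, le_rfl, by simp⟩
  have he0 : e ≠ 0 := by
    intro h0
    have h1 : S.one = 0 := congrArg Subtype.val h0
    obtain ⟨r, hr, h2⟩ := S.orderUnit (x := -mat1 ((ε : ℂ) • S.one + a))
      (by
        have := isHermitian_mat1 (v := (ε : ℂ) • S.one + a) (by simp [ha, S.star_one])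
        exact this.neg)
    rw [unitMatrix_one, h1] at h2
    have h3 : mat1 (0 : V) = 0 := rfl
    rw [h3, smul_zero, zero_sub, neg_neg] at h2
    exact hn (by rw [h1]; exact h2)
  obtain ⟨g, hg, hgC⟩ := riesz_extension C (LinearPMap.mkSpanSingleton e (1 : ℝ) he0)
    (by
      rintro ⟨x, hx⟩ hxC
      obtain ⟨l, rfl⟩ := Submodule.mem_span_singleton.1 hx
      rw [show LinearPMap.mkSpanSingleton e (1 : ℝ) he0 ⟨l • e, hx⟩ = l • (1 : ℝ) from
        LinearPMap.mkSpanSingleton'_apply e (1 : ℝ) _ l hx]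
      obtain ⟨c, hc, t, ht, hct⟩ := hxC
      simp only [smul_eq_mul, mul_one]
      by_contra! hl
      have h1 : t • b = c + (-l) • e := by
        change l • e = _ at hct
        rw [neg_smul, hct]; abel
      have h2 : mat1 ((t • b : selfAdjoint V) : V) ∈ S.pos 1 := by
        rw [h1, AddSubgroup.coe_add, mat1_add, hsm, mat1_smul]
        exact S.add_mem hc (S.smul_mem S.one_mem_one (by linarith))
      rcases ht.eq_or_lt with rfl | ht
      · rw [zero_smul] at h1
        have h3 : c = l • e := by
          rw [neg_smul, eq_comm, add_neg_eq_zero] at h1; exact h1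
        have h4 : mat1 ((-e : selfAdjoint V) : V) ∈ S.pos 1 := by
          have : -e = (-l)⁻¹ • c := by
            rw [h3, smul_smul, inv_neg, neg_mul, inv_mul_cancel₀ hl.ne, neg_one_smul]
          rw [this, hsm, mat1_smul]
          exact S.smul_mem hc (inv_nonneg.2 (by linarith))
        have h5 := S.proper S.one_mem_one h4
        exact he0 (Subtype.ext (congrFun (congrFun h5 0) 0))
      · have h3 : b = t⁻¹ • (t • b) := by rw [smul_smul, inv_mul_cancel₀ ht.ne', one_smul]
        have h4 : mat1 (b : V) ∈ S.pos 1 := by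
          rw [h3, hsm, mat1_smul]
          exact S.smul_mem h2 (inv_nonneg.2 ht.le)
        exact hn h4)
    (by
      intro y
      obtain ⟨r, hr, h2⟩ := S.orderUnit (x := -mat1 (y : V))
        (isHermitian_mat1 (selfAdjoint.mem_iff.1 y.2)).neg
      refine ⟨⟨r • e, Submodule.mem_span_singleton.2 ⟨r, rfl⟩⟩, hC _ ?_⟩
      rw [unitMatrix_one, sub_neg_eq_add] at h2
      change mat1 (((r • e : selfAdjoint V) : V) + (y : V)) ∈ S.pos 1
      rw [mat1_add, hsm, mat1_smul]
      exact h2)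
  have hge : g e = 1 := by
    have := hg ⟨e, Submodule.mem_span_singleton_self e⟩
    rw [this]
    exact LinearPMap.mkSpanSingleton_apply ℝ ℝ he0 (1 : ℝ)
  have hgb : g b ≤ 0 := by
    have := hgC (-b) ⟨0, S.zero_mem 1, 1, zero_le_one, by simp⟩
    rw [map_neg] at this
    linarith
  let F : V →ₗ[ℂ] ℂ := Module.Dual.extendRCLike (𝕜 := ℂ) (g ∘ₗ realPart)
  have hF : ∀ v : selfAdjoint V, F (v : V) = ((g v : ℝ) : ℂ) := by
    intro v
    have h1 : realPart (v : V) = v := v.2.coe_realPart |> Subtype.ext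
    have h2 : realPart (Complex.I • (v : V)) = 0 := by
      rw [realPart_I_smul, IsSelfAdjoint.imaginaryPart v.2, neg_zero]
    change (_ : ℂ) - _ * _ = _
    simp [h1, h2]
  refine ⟨F, ⟨?_, ?_⟩, ?_⟩
  · have := hF e
    rw [hge] at this
    simpa using this
  · intro v hv
    have hv' : star v = v := congrFun (congrFun (S.isHermitian hv) 0) 0
    rw [hF ⟨v, hv'⟩]
    exact_mod_cast hgC _ (hC _ hv)
  · have h1 : (⟨a, ha⟩ : selfAdjoint V) = b - ε • e := by
      apply Subtype.ext
      simp [b, e]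
    have h2 := hF ⟨a, ha⟩
    rw [h1, map_sub, map_smul, hge] at h2
    rw [← h1] at h2
    change F a = _ at h2
    rw [h2]
    have : g b - ε • (1 : ℝ) < 0 := by simp; linarith
    exact_mod_cast this

variable {S}

theorem IsState.map_star {f : V →ₗ[ℂ] ℂ} (hf : S.IsState f) (v : V) : f (star v) = star (f v) := by
  have key : ∀ a : V, star a = a → star (f a) = f a := by
    intro a ha
    obtain ⟨r, hr, h⟩ := S.orderUnit (isHermitian_mat1 ha)
    rw [unitMatrix_one] at h
    have h2 := hf.2 ((r : ℂ) • S.one - a) h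
    rw [map_sub, map_smul, hf.1, smul_eq_mul, mul_one] at h2
    have h3 := (IsSelfAdjoint.of_nonneg h2).star_eq
    rw [star_sub, Complex.star_def, Complex.conj_ofReal] at h3
    exact sub_right_injective h3
  have h1 := key (v + star v) (by rw [star_add, star_star, add_comm])
  have h2 := key (Complex.I • (v - star v)) (by
    rw [star_smul, star_sub, star_star, Complex.star_def, Complex.conj_I]
    module)
  simp only [map_add, map_sub, map_smul, smul_eq_mul, star_mul', star_add, star_sub,
    Complex.star_def, Complex.conj_I] at h1 h2
  have h3 : -(star (f v) - star (f (star v))) = f v - f (star v) := by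
    apply mul_left_cancel₀ Complex.I_ne_zero
    rw [← h2]; simp only [Complex.star_def]; ring
  simp only [Complex.star_def] at h3 ⊢
  linear_combination (1 / 2 : ℂ) * h3 - (1 / 2 : ℂ) * h1

/-- The states of an operator system separate its points. -/
theorem eq_zero_of_states {v : V} (h : ∀ f, S.IsState f → f v = 0) : v = 0 := by
  have key : ∀ a : V, star a = a → (∀ f, S.IsState f → f a = 0) → a = 0 := by
    intro a ha hfa
    have h1 : mat1 a ∈ S.pos 1 := by
      by_contra hc
      obtain ⟨f, hf, hlt⟩ := S.exists_state_neg ha hc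
      exact hlt.ne (hfa f hf)
    have h2 : mat1 (-a) ∈ S.pos 1 := by
      by_contra hc
      obtain ⟨f, hf, hlt⟩ := S.exists_state_neg (a := -a) (by rw [star_neg, ha]) hc
      exact hlt.ne (by rw [map_neg, hfa f hf, neg_zero])
    exact congrFun (congrFun (S.proper h1 h2) 0) 0
  have h1 := key (v + star v) (by rw [star_add, star_star, add_comm]) fun f hf => by
    rw [map_add, hf.map_star, h f hf]; simp
  have h2 := key (Complex.I • (v - star v)) (by
    rw [star_smul, star_sub, star_star, Complex.star_def, Complex.conj_I]
    module) fun f hf => by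
    rw [map_smul, map_sub, hf.map_star, h f hf]; simp
  have h3 : v - star v = 0 := by
    simpa [Complex.I_ne_zero] using h2
  have h4 : (2 : ℂ) • v = 0 := by
    calc (2 : ℂ) • v = (v + star v) + (v - star v) := by module
      _ = 0 := by rw [h1, h3, add_zero]
  simpa using h4

theorem IsState.map_posSemidef {f : V →ₗ[ℂ] ℂ} (hf : S.IsState f) {n : ℕ}
    {x : Matrix (Fin n) (Fin n) V} (hx : x ∈ S.pos n) : (x.map f).PosSemidef := by
  refine Matrix.PosSemidef.of_dotProduct_mulVec_nonneg ?_ fun u => ?_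
  · ext i j
    have := congrFun (congrFun (S.isHermitian hx) i) j
    simp only [Matrix.conjTranspose_apply, Matrix.map_apply] at this ⊢
    rw [← hf.map_star, this]
  · have h := S.congr_mem (Matrix.of fun (_ : Fin 1) i => star (u i)) hx
    have h2 := hf.2 (congrBy (Matrix.of fun (_ : Fin 1) i => star (u i)) x 0 0) (by
      convert h using 1
      ext i j
      rw [Subsingleton.elim i 0, Subsingleton.elim j 0]; rfl)
    convert h2 using 1
    simp only [congrBy, Matrix.of_apply, dotProduct, Matrix.mulVec, Matrix.map_apply, map_sum,
      map_smul, smul_eq_mul, Finset.mul_sum, Pi.star_apply, star_star]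
    refine Finset.sum_congr rfl fun k _ => Finset.sum_congr rfl fun l _ => by ring

end OperatorSystem

end States
section Constructions

variable {V W U : Type*} [AddCommGroup V] [Module ℂ V] [StarAddMonoid V] [StarModule ℂ V]
  [AddCommGroup W] [Module ℂ W] [StarAddMonoid W] [StarModule ℂ W]
  [AddCommGroup U] [Module ℂ U] [StarAddMonoid U] [StarModule ℂ U]

namespace OperatorSystem

/-! ### Positivity of linear and bilinear maps -/

/-- `f` is `k`-positive: `f_k` maps `M_k(S)^+` into `M_k(T)^+`. -/
def IsKPositive (S : OperatorSystem V) (T : OperatorSystem W) (k : ℕ) (f : V →ₗ[ℂ] W) : Prop :=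
  ∀ x ∈ S.pos k, x.map f ∈ T.pos k

/-- `f` is completely positive. -/
def IsCompletelyPositive (S : OperatorSystem V) (T : OperatorSystem W) (f : V →ₗ[ℂ] W) : Prop :=
  ∀ k : ℕ, S.IsKPositive T k f

/-- The bilinear map `φ` is `(p, q, r)`-positive: `α [φ(x_{ij}, y_{kl})] α* ∈ M_r(R)^+` for all
`x ∈ M_p(S)^+`, `y ∈ M_q(T)^+` and `α ∈ M_{r,pq}`. -/
def IsPQRPositive (S : OperatorSystem V) (T : OperatorSystem W) (R : OperatorSystem U)
    (p q r : ℕ) (φ : V →ₗ[ℂ] W →ₗ[ℂ] U) : Prop :=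
  ∀ x ∈ S.pos p, ∀ y ∈ T.pos q, ∀ α : Matrix (Fin r) (Fin p × Fin q) ℂ,
    congrBy α (Matrix.kroneckerMap (fun a b => φ a b) x y) ∈ R.pos r

/-! ### The super `k`-maximal operator system -/

/-- The cones `D_n^{max,k}(S)` of all `α diag(s_1, …, s_m) α*` with `s_i ∈ M_k(S)^+`. -/
def omaxOrdering (S : OperatorSystem V) (k : ℕ) : MatrixOrdering V where
  pos n := {x | ∃ (m : ℕ) (s : Fin m → Matrix (Fin k) (Fin k) V)
    (α : Matrix (Fin n) (Fin k × Fin m) ℂ),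
    (∀ i, s i ∈ S.pos k) ∧ x = congrBy α (Matrix.blockDiagonal s)}
  isHermitian := by
    rintro n _ ⟨m, s, α, hs, rfl⟩
    refine isHermitian_congrBy α ?_
    rw [Matrix.IsHermitian, Matrix.blockDiagonal_conjTranspose]
    exact congrArg _ (funext fun i => S.isHermitian (hs i))
  zero_mem n := ⟨0, fun _ => 0, 0, fun _ => S.zero_mem k, by ext i j; simp [congrBy]⟩
  add_mem := by
    rintro n _ _ ⟨m, s, α, hs, rfl⟩ ⟨m', s', α', hs', rfl⟩
    refine ⟨m + m', Fin.append s s',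
      Matrix.of fun a b => Fin.append (fun i => α a (b.1, i)) (fun i => α' a (b.1, i)) b.2, ?_, ?_⟩
    · intro i
      refine Fin.addCases (fun i => ?_) (fun i => ?_) i
      · rw [Fin.append_left]; exact hs i
      · rw [Fin.append_right]; exact hs' i
    · rw [congrBy_blockDiagonal, congrBy_blockDiagonal, congrBy_blockDiagonal, Fin.sum_univ_add]
      simp [Fin.append_left, Fin.append_right]
  congr_mem := by
    rintro n n' β _ ⟨m, s, α, hs, rfl⟩
    exact ⟨m, s, β * α, hs, congrBy_congrBy β α _⟩

theorem omaxOrdering_le (S : OperatorSystem V) (k : ℕ) {n : ℕ} {x : Matrix (Fin n) (Fin n) V}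
    (hx : x ∈ (S.omaxOrdering k).pos n) : x ∈ S.pos n := by
  obtain ⟨m, s, α, hs, rfl⟩ := hx
  rw [congrBy_blockDiagonal]
  exact S.sum_mem _ fun i _ => S.congr_mem _ (hs i)

theorem omaxOrdering_one (S : OperatorSystem V) (k : ℕ) [NeZero k] {x : Matrix (Fin 1) (Fin 1) V}
    (hx : x ∈ S.pos 1) : x ∈ (S.omaxOrdering k).pos 1 := by
  refine ⟨1, fun _ => congrBy (Matrix.of fun i (_ : Fin 1) => if i = 0 then 1 else 0) x,
    Matrix.of fun _ b => if b.1 = 0 then 1 else 0, fun _ => S.congr_mem _ hx, ?_⟩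
  rw [congrBy_blockDiagonal]
  ext i j
  rw [Subsingleton.elim i 0, Subsingleton.elim j 0]
  simp [congrBy]

/-- The super `k`-maximal operator system `OMAX^k(S)`. -/
def OMAX (S : OperatorSystem V) (k : ℕ) [NeZero k] : OperatorSystem V :=
  (S.omaxOrdering k).archimedeanization S.one S.star_one
    (fun hx => MatrixOrdering.orderUnit_of_one _ (fun v hv => by
      obtain ⟨r, hr, h⟩ := S.orderUnit (isHermitian_mat1 hv)
      rw [unitMatrix_one] at h
      exact ⟨r, hr, S.omaxOrdering_one k h⟩) hx)
    (fun hx hx' => S.proper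
      (S.archimedean fun ε hε => S.omaxOrdering_le k (hx ε hε))
      (S.archimedean fun ε hε => S.omaxOrdering_le k (hx' ε hε)))

/-! ### The super `k`-minimal operator system -/

theorem posSemidef_antisymm {ι : Type*} [Fintype ι] {A : Matrix ι ι ℂ} (h : A.PosSemidef)
    (h' : (-A).PosSemidef) : A = 0 := by
  open scoped MatrixOrder in
  have h1 : (0 : Matrix ι ι ℂ) ≤ A := Matrix.nonneg_iff_posSemidef.2 h
  have h2 : (0 : Matrix ι ι ℂ) ≤ -A := Matrix.nonneg_iff_posSemidef.2 h'
  exact le_antisymm (neg_nonneg.1 h2) h1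

theorem posSemidef_archimedean {ι : Type*} [Fintype ι] {A M : Matrix ι ι ℂ}
    (h : ∀ ε : ℝ, 0 < ε → ((ε : ℂ) • M + A).PosSemidef) : A.PosSemidef := by
  refine Matrix.PosSemidef.of_dotProduct_mulVec_nonneg ?_ fun u => ?_
  · have h1 := isHermitian_real_smul 2 (h 1 one_pos).1
    have h2 := h1.sub (h 2 two_pos).1
    convert h2 using 1
    push_cast
    module
  · have h1 : ∀ ε : ℝ, 0 < ε → 0 ≤ (ε : ℂ) * (star u ⬝ᵥ M *ᵥ u) + star u ⬝ᵥ A *ᵥ u := by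
      intro ε hε
      have := (h ε hε).dotProduct_mulVec_nonneg u
      rwa [Matrix.add_mulVec, Matrix.smul_mulVec, dotProduct_add, dotProduct_smul,
        smul_eq_mul] at this
    have h2 : Filter.Tendsto (fun ε : ℝ => (ε : ℂ) * (star u ⬝ᵥ M *ᵥ u) + star u ⬝ᵥ A *ᵥ u)
        (nhdsWithin 0 (Set.Ioi 0)) (nhds (star u ⬝ᵥ A *ᵥ u)) := by
      have hc : Continuous fun ε : ℝ => (ε : ℂ) * (star u ⬝ᵥ M *ᵥ u) + star u ⬝ᵥ A *ᵥ u := by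
        fun_prop
      have := (hc.tendsto 0).mono_left (nhdsWithin_le_nhds (s := Set.Ioi 0))
      simpa using this
    refine ge_of_tendsto h2 ?_
    filter_upwards [self_mem_nhdsWithin] with ε hε using h1 ε hε

/-- `φ : S → M_k` is unital completely positive; `M_n(M_k)` is identified with the matrices
indexed by `{1, …, n} × {1, …, k}`. -/
def IsUCP (S : OperatorSystem V) (k : ℕ) (φ : V →ₗ[ℂ] Matrix (Fin k) (Fin k) ℂ) : Prop :=
  φ S.one = 1 ∧ ∀ n : ℕ, ∀ x ∈ S.pos n,
    (Matrix.comp (Fin n) (Fin n) (Fin k) (Fin k) ℂ (x.map φ)).PosSemidef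

theorem IsState.isUCP {S : OperatorSystem V} {f : V →ₗ[ℂ] ℂ} (hf : S.IsState f) (k : ℕ) :
    S.IsUCP k (LinearMap.smulRight f (1 : Matrix (Fin k) (Fin k) ℂ)) := by
  refine ⟨by simp [hf.1], fun n x hx => ?_⟩
  have h := (hf.map_posSemidef hx).kronecker (Matrix.PosSemidef.one (n := Fin k) (R := ℂ))
  have e : Matrix.comp (Fin n) (Fin n) (Fin k) (Fin k) ℂ
      (x.map (LinearMap.smulRight f (1 : Matrix (Fin k) (Fin k) ℂ))) =
      Matrix.kronecker (x.map f) (1 : Matrix (Fin k) (Fin k) ℂ) := by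
    ext i j; simp
  rw [e]
  exact h

theorem comp_congrBy {m n k : ℕ} (φ : V →ₗ[ℂ] Matrix (Fin k) (Fin k) ℂ)
    (α : Matrix (Fin m) (Fin n) ℂ) (x : Matrix (Fin n) (Fin n) V) :
    Matrix.comp (Fin m) (Fin m) (Fin k) (Fin k) ℂ ((congrBy α x).map φ) =
      Matrix.kronecker α (1 : Matrix (Fin k) (Fin k) ℂ) *
        Matrix.comp (Fin n) (Fin n) (Fin k) (Fin k) ℂ (x.map φ) *
        (Matrix.kronecker α (1 : Matrix (Fin k) (Fin k) ℂ))ᴴ := by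
  rw [congrBy_map, ← congrBy_eq_mul]
  ext ⟨i, a⟩ ⟨j, b⟩
  have h1 : ∀ (i : Fin m) (a : Fin k) (c : Fin n) (d : Fin k),
      Matrix.kronecker α (1 : Matrix (Fin k) (Fin k) ℂ) (i, a) (c, d) =
        if a = d then α i c else 0 := by
    intro i a c d; simp [Matrix.one_apply]
  simp only [congrBy, Matrix.comp_apply, Matrix.of_apply, Matrix.sum_apply, Matrix.smul_apply,
    Fintype.sum_prod_type, h1, smul_eq_mul, Matrix.map_apply, mul_ite, mul_one, mul_zero, ite_mul,
    zero_mul, apply_ite star, star_zero]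
  simp

/-- The super `k`-minimal operator system `OMIN^k(S)`. -/
def OMIN (S : OperatorSystem V) (k : ℕ) [NeZero k] : OperatorSystem V where
  pos n := {x | ∀ φ : V →ₗ[ℂ] Matrix (Fin k) (Fin k) ℂ, S.IsUCP k φ →
    (Matrix.comp (Fin n) (Fin n) (Fin k) (Fin k) ℂ (x.map φ)).PosSemidef}
  isHermitian {n x} hx := by
    ext i j
    rw [Matrix.conjTranspose_apply, ← sub_eq_zero]
    refine S.eq_zero_of_states fun f hf => ?_
    have h := (hx _ (hf.isUCP k)).1
    have h2 := congrFun (congrFun h (i, 0)) (j, 0)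
    simp only [Matrix.conjTranspose_apply, Matrix.comp_apply, Matrix.map_apply,
      LinearMap.smulRight_apply, Matrix.smul_apply, Matrix.one_apply_eq, smul_eq_mul, mul_one] at h2
    rw [map_sub, hf.map_star, h2, sub_self]
  zero_mem n φ _ := by
    convert Matrix.PosSemidef.zero (n := Fin n × Fin k) (R := ℂ)
    ext i j; simp
  add_mem {n x y} hx hy φ hφ := by
    convert (hx φ hφ).add (hy φ hφ) using 1
    ext i j; simp
  congr_mem {m n} α {x} hx φ hφ := by
    rw [comp_congrBy]
    exact (hx φ hφ).mul_mul_conjTranspose_same _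
  one := S.one
  star_one := S.star_one
  proper {n x} hx hx' := by
    ext i j
    refine S.eq_zero_of_states fun f hf => ?_
    have h' := hx' _ (hf.isUCP k)
    have e : Matrix.comp (Fin n) (Fin n) (Fin k) (Fin k) ℂ
        ((-x).map (LinearMap.smulRight f (1 : Matrix (Fin k) (Fin k) ℂ))) =
        -Matrix.comp (Fin n) (Fin n) (Fin k) (Fin k) ℂ
        (x.map (LinearMap.smulRight f (1 : Matrix (Fin k) (Fin k) ℂ))) := by
      ext i j; simp
    rw [e] at h'
    have h := congrFun (congrFun (posSemidef_antisymm (hx _ (hf.isUCP k)) h') (i, 0)) (j, 0)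
    simpa using h
  orderUnit {n x} hx := by
    obtain ⟨r, hr, h⟩ := S.orderUnit hx
    exact ⟨r, hr, fun φ hφ => hφ.2 n _ h⟩
  archimedean {n x} hx φ hφ := by
    refine posSemidef_archimedean (M := Matrix.comp (Fin n) (Fin n) (Fin k) (Fin k) ℂ
      ((unitMatrix n S.one).map φ)) fun ε hε => ?_
    convert hx ε hε φ hφ using 1
    ext i j; simp

/-! ### The maximal tensor product -/

/-- The direct sum `x ⊕ y` of two matrices. -/
def dsum {k l : ℕ} (x : Matrix (Fin k) (Fin k) V) (y : Matrix (Fin l) (Fin l) V) :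
    Matrix (Fin (k + l)) (Fin (k + l)) V :=
  congrBy (Matrix.of fun a i => if a = Fin.castAdd l i then 1 else 0) x +
    congrBy (Matrix.of fun a i => if a = Fin.natAdd k i then 1 else 0) y

theorem dsum_mem (S : OperatorSystem V) {k l : ℕ} {x : Matrix (Fin k) (Fin k) V}
    {y : Matrix (Fin l) (Fin l) V} (hx : x ∈ S.pos k) (hy : y ∈ S.pos l) :
    dsum x y ∈ S.pos (k + l) :=
  S.add_mem (S.congr_mem _ hx) (S.congr_mem _ hy)

theorem dsum_left {k l : ℕ} (x : Matrix (Fin k) (Fin k) V) (y : Matrix (Fin l) (Fin l) V)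
    (i j : Fin k) : dsum x y (Fin.castAdd l i) (Fin.castAdd l j) = x i j := by
  have h : ∀ (i : Fin k) (j : Fin l), ¬ Fin.castAdd l i = Fin.natAdd k j := by
    intro i j h
    have := congrArg Fin.val h
    simp at this; omega
  simp [dsum, congrBy, h, apply_ite (starRingEnd ℂ)]

theorem dsum_left_right {k l : ℕ} (x : Matrix (Fin k) (Fin k) V) (y : Matrix (Fin l) (Fin l) V)
    (i : Fin k) (j : Fin l) : dsum x y (Fin.castAdd l i) (Fin.natAdd k j) = 0 := by
  have h : ∀ (i : Fin k) (j : Fin l), ¬ Fin.castAdd l i = Fin.natAdd k j := by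
    intro i j h
    have := congrArg Fin.val h
    simp at this; omega
  have h' : ∀ (i : Fin k) (j : Fin l), ¬ Fin.natAdd k j = Fin.castAdd l i :=
    fun i j hij => h i j hij.symm
  simp [dsum, congrBy, h, h', apply_ite (starRingEnd ℂ)]

theorem dsum_right_left {k l : ℕ} (x : Matrix (Fin k) (Fin k) V) (y : Matrix (Fin l) (Fin l) V)
    (i : Fin l) (j : Fin k) : dsum x y (Fin.natAdd k i) (Fin.castAdd l j) = 0 := by
  have h : ∀ (i : Fin k) (j : Fin l), ¬ Fin.castAdd l i = Fin.natAdd k j := by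
    intro i j h
    have := congrArg Fin.val h
    simp at this; omega
  have h' : ∀ (i : Fin k) (j : Fin l), ¬ Fin.natAdd k j = Fin.castAdd l i :=
    fun i j hij => h i j hij.symm
  simp [dsum, congrBy, h, h', apply_ite (starRingEnd ℂ)]

theorem dsum_right {k l : ℕ} (x : Matrix (Fin k) (Fin k) V) (y : Matrix (Fin l) (Fin l) V)
    (i j : Fin l) : dsum x y (Fin.natAdd k i) (Fin.natAdd k j) = y i j := by
  have h : ∀ (i : Fin k) (j : Fin l), ¬ Fin.natAdd k j = Fin.castAdd l i := by
    intro i j h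
    have := congrArg Fin.val h
    simp at this; omega
  simp [dsum, congrBy, h, apply_ite (starRingEnd ℂ)]

/-- The cones `D_n^{max}(S, T)` of all `α (P ⊗ Q) α*` with `P ∈ M_k(S)^+` and `Q ∈ M_l(T)^+`. -/
def maxOrdering (S : OperatorSystem V) (T : OperatorSystem W) : MatrixOrdering (V ⊗[ℂ] W) where
  pos n := {z | ∃ (k l : ℕ) (P : Matrix (Fin k) (Fin k) V) (Q : Matrix (Fin l) (Fin l) W)
    (α : Matrix (Fin n) (Fin k × Fin l) ℂ), P ∈ S.pos k ∧ Q ∈ T.pos l ∧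
      z = congrBy α (Matrix.kroneckerMap (fun a b => a ⊗ₜ[ℂ] b) P Q)}
  isHermitian := by
    rintro n _ ⟨k, l, P, Q, α, hP, hQ, rfl⟩
    refine isHermitian_congrBy α ?_
    ext ⟨i, j⟩ ⟨i', j'⟩
    have h1 := congrFun (congrFun (S.isHermitian hP) i) i'
    have h2 := congrFun (congrFun (T.isHermitian hQ) j) j'
    simp only [Matrix.conjTranspose_apply] at h1 h2
    simp [h1, h2]
  zero_mem n := ⟨0, 0, 0, 0, 0, S.zero_mem 0, T.zero_mem 0, by ext i j; simp [congrBy]⟩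
  add_mem := by
    rintro n _ _ ⟨k, l, P, Q, α, hP, hQ, rfl⟩ ⟨k', l', P', Q', α', hP', hQ', rfl⟩
    refine ⟨k + k', l + l', dsum P P', dsum Q Q', Matrix.of fun a b =>
      Fin.append (fun i => Fin.append (fun j => α a (i, j)) (fun _ => 0) b.2)
        (fun i => Fin.append (fun _ => 0) (fun j => α' a (i, j)) b.2) b.1,
      S.dsum_mem hP hP', T.dsum_mem hQ hQ', ?_⟩
    ext a b
    simp [congrBy, Fintype.sum_prod_type, Fin.sum_univ_add, Fin.append_left, Fin.append_right,
      dsum_left, dsum_right, dsum_left_right, dsum_right_left, Finset.sum_add_distrib]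
  congr_mem := by
    rintro n n' β _ ⟨k, l, P, Q, α, hP, hQ, rfl⟩
    exact ⟨k, l, P, Q, β * α, hP, hQ, congrBy_congrBy β α _⟩

theorem tmul_mem_maxOrdering (S : OperatorSystem V) (T : OperatorSystem W) {v : V} {w : W}
    (hv : mat1 v ∈ S.pos 1) (hw : mat1 w ∈ T.pos 1) :
    mat1 (v ⊗ₜ[ℂ] w) ∈ (maxOrdering S T).pos 1 := by
  refine ⟨1, 1, mat1 v, mat1 w, Matrix.of fun _ _ => 1, hv, hw, ?_⟩
  ext i j
  simp [mat1, congrBy, Fintype.sum_prod_type]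

theorem maxOrdering_orderUnit (S : OperatorSystem V) (T : OperatorSystem W) {z : V ⊗[ℂ] W}
    (hz : star z = z) : ∃ r : ℝ, 0 < r ∧
      (r : ℂ) • mat1 (S.one ⊗ₜ[ℂ] T.one) - mat1 z ∈ (maxOrdering S T).pos 1 := by
  have mat1_add : ∀ v w : V ⊗[ℂ] W, mat1 (v + w) = mat1 v + mat1 w := fun v w => rfl
  have mat1_smul : ∀ (c : ℂ) (v : V ⊗[ℂ] W), mat1 (c • v) = c • mat1 v := fun v w => rfl
  have mat1_sub : ∀ v w : V ⊗[ℂ] W, mat1 (v - w) = mat1 v - mat1 w := fun v w => rfl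
  have mat1_zero : mat1 (0 : V ⊗[ℂ] W) = 0 := rfl
  have hone := tmul_mem_maxOrdering S T S.one_mem_one T.one_mem_one
  let P : V ⊗[ℂ] W → Prop := fun z => ∃ r : ℝ, 0 < r ∧
      (r : ℂ) • mat1 (S.one ⊗ₜ[ℂ] T.one) - mat1 z ∈ (maxOrdering S T).pos 1
  have hPadd : ∀ x y, P x → P y → P (x + y) := by
    rintro x y ⟨r, hr, h⟩ ⟨s, hs, h'⟩
    refine ⟨r + s, add_pos hr hs, ?_⟩
    convert (maxOrdering S T).add_mem h h' using 1
    rw [mat1_add]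
    push_cast
    module
  have hprod : ∀ (a : V) (c : W), star a = a → star c = c → P ((2 : ℂ) • a ⊗ₜ[ℂ] c) := by
    intro a c ha hc
    obtain ⟨r, hr, h1⟩ := S.orderUnit (isHermitian_mat1 ha)
    obtain ⟨r', hr', h2⟩ := S.orderUnit (isHermitian_mat1 ha).neg
    obtain ⟨s, hs, h3⟩ := T.orderUnit (isHermitian_mat1 hc)
    obtain ⟨s', hs', h4⟩ := T.orderUnit (isHermitian_mat1 hc).neg
    rw [unitMatrix_one] at h1 h2 h3 h4
    have k1 : mat1 (((r + r' : ℝ) : ℂ) • S.one - a) ∈ S.pos 1 := by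
      convert S.add_mem h1 (S.smul_mem S.one_mem_one hr'.le) using 1
      ext; simp [mat1, add_smul]; abel
    have k2 : mat1 (((r + r' : ℝ) : ℂ) • S.one + a) ∈ S.pos 1 := by
      convert S.add_mem h2 (S.smul_mem S.one_mem_one hr.le) using 1
      ext; simp [mat1, add_smul]; abel
    have k3 : mat1 (((s + s' : ℝ) : ℂ) • T.one - c) ∈ T.pos 1 := by
      convert T.add_mem h3 (T.smul_mem T.one_mem_one hs'.le) using 1
      ext; simp [mat1, add_smul]; abel
    have k4 : mat1 (((s + s' : ℝ) : ℂ) • T.one + c) ∈ T.pos 1 := by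
      convert T.add_mem h4 (T.smul_mem T.one_mem_one hs.le) using 1
      ext; simp [mat1, add_smul]; abel
    refine ⟨2 * (r + r') * (s + s'), by positivity, ?_⟩
    convert (maxOrdering S T).add_mem (tmul_mem_maxOrdering S T k2 k3)
      (tmul_mem_maxOrdering S T k1 k4) using 1
    rw [← mat1_smul, ← mat1_add, ← mat1_sub]
    congr 1
    simp only [TensorProduct.add_tmul, TensorProduct.sub_tmul, TensorProduct.tmul_add,
      TensorProduct.tmul_sub, ← TensorProduct.smul_tmul', TensorProduct.tmul_smul]
    push_cast
    module
  have hQ : ∀ z, P (z + star z) := by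
    intro z
    induction z using TensorProduct.induction_on with
    | zero => exact ⟨1, one_pos, by simpa [mat1_zero] using hone⟩
    | add x y hx hy =>
      convert hPadd _ _ hx hy using 1
      rw [star_add]; abel
    | tmul v w =>
      have h1 := hprod ((1 / 2 : ℂ) • (v + star v)) ((1 / 2 : ℂ) • (w + star w))
        (by simp [add_comm]) (by simp [add_comm])
      have h2 := hprod ((1 / 2 : ℂ) • (Complex.I • (v - star v)))
        ((1 / 2 : ℂ) • (-Complex.I • (w - star w))) (by
          simp only [star_smul, star_sub, star_star, Complex.star_def, Complex.conj_I, map_div₀,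
            map_one, map_ofNat]
          module) (by
          simp only [star_smul, star_sub, star_star, Complex.star_def, Complex.conj_I, map_div₀,
            map_one, map_ofNat, map_neg]
          module)
      convert hPadd _ _ h1 h2 using 1
      rw [TensorProduct.star_tmul]
      have hI := Complex.I_mul_I
      simp only [TensorProduct.add_tmul, TensorProduct.sub_tmul, TensorProduct.tmul_add,
        TensorProduct.tmul_sub, ← TensorProduct.smul_tmul', TensorProduct.tmul_smul]
      match_scalars <;> ring_nf <;> simp [Complex.I_sq] <;> norm_num
  obtain ⟨r, hr, h⟩ := hQ z
  rw [hz] at h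
  refine ⟨r / 2, by positivity, ?_⟩
  convert (maxOrdering S T).smul_mem h (t := 1 / 2) (by norm_num) using 1
  rw [mat1_add]
  push_cast
  module

theorem maxOrdering_proper (S : OperatorSystem V) (T : OperatorSystem W) {n : ℕ}
    {z : Matrix (Fin n) (Fin n) (V ⊗[ℂ] W)}
    (h : ∀ ε : ℝ, 0 < ε → (ε : ℂ) • unitMatrix n (S.one ⊗ₜ[ℂ] T.one) + z ∈ (maxOrdering S T).pos n)
    (h' : ∀ ε : ℝ, 0 < ε →
      (ε : ℂ) • unitMatrix n (S.one ⊗ₜ[ℂ] T.one) + -z ∈ (maxOrdering S T).pos n) : z = 0 := by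
  let F : (V →ₗ[ℂ] ℂ) → (W →ₗ[ℂ] ℂ) → (V ⊗[ℂ] W →ₗ[ℂ] ℂ) := fun f g =>
    TensorProduct.lift ((LinearMap.mul ℂ ℂ).compl₁₂ f g)
  have hF : ∀ f g v w, F f g (v ⊗ₜ[ℂ] w) = f v * g w := fun f g v w => by simp [F]
  have hpsd : ∀ f g, S.IsState f → T.IsState g → ∀ x : Matrix (Fin n) (Fin n) (V ⊗[ℂ] W),
      x ∈ (maxOrdering S T).pos n → (x.map (F f g)).PosSemidef := by
    rintro f g hf hg _ ⟨k, l, P, Q, α, hP, hQ, rfl⟩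
    rw [congrBy_map, congrBy_eq_mul]
    refine Matrix.PosSemidef.mul_mul_conjTranspose_same ?_ _
    have h1 := (hf.map_posSemidef hP).kronecker (hg.map_posSemidef hQ)
    have e : (Matrix.kroneckerMap (fun a b => a ⊗ₜ[ℂ] b) P Q).map (F f g) =
        Matrix.kronecker (P.map f) (Q.map g) := by
      ext i j; simp [hF]
    rw [e]
    exact h1
  have hA : ∀ f g, S.IsState f → T.IsState g → z.map (F f g) = 0 := by
    intro f g hf hg
    refine posSemidef_antisymm
      (posSemidef_archimedean (M := (unitMatrix n (S.one ⊗ₜ[ℂ] T.one)).map (F f g)) fun ε hε => ?_)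
      (posSemidef_archimedean (M := (unitMatrix n (S.one ⊗ₜ[ℂ] T.one)).map (F f g)) fun ε hε => ?_)
    · convert hpsd f g hf hg _ (h ε hε) using 1
      ext i j; simp
    · convert hpsd f g hf hg _ (h' ε hε) using 1
      ext i j; simp
  have hsep : ∀ t : V ⊗[ℂ] W, (∀ f g, S.IsState f → T.IsState g → F f g t = 0) → t = 0 := by
    intro t ht
    classical
    let b := Module.Basis.ofVectorSpace ℂ V
    let E := TensorProduct.equivFinsuppOfBasisLeft (N := W) b
    let G : (W →ₗ[ℂ] ℂ) → (V ⊗[ℂ] W →ₗ[ℂ] V) := fun g =>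
      (TensorProduct.rid ℂ V).toLinearMap ∘ₗ LinearMap.lTensor V g
    have hG : ∀ f g, F f g = f ∘ₗ G g := by
      intro f g
      refine TensorProduct.ext' fun v w => ?_
      simp [F, G, mul_comm]
    have hGz : ∀ g, T.IsState g → G g t = 0 := by
      intro g hg
      refine S.eq_zero_of_states fun f hf => ?_
      have := ht f g hf hg
      rwa [hG] at this
    have hE : ∀ g i (t : V ⊗[ℂ] W), g (E t i) = b.repr (G g t) i := by
      intro g i t
      induction t using TensorProduct.induction_on with
      | zero => simp
      | add x y hx hy => simp [hx, hy]
      | tmul v w =>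
        simp [E, G, TensorProduct.equivFinsuppOfBasisLeft_apply_tmul_apply, mul_comm]
    apply E.injective
    rw [map_zero]
    ext i
    refine T.eq_zero_of_states fun g hg => ?_
    rw [hE, hGz g hg]
    simp
  ext i j
  refine hsep _ fun f g hf hg => ?_
  exact congrFun (congrFun (hA f g hf hg) i) j

/-- The maximal tensor product `S ⊗_max T`. -/
def maxTensor (S : OperatorSystem V) (T : OperatorSystem W) : OperatorSystem (V ⊗[ℂ] W) :=
  (maxOrdering S T).archimedeanization (S.one ⊗ₜ[ℂ] T.one)
    (by rw [TensorProduct.star_tmul, S.star_one, T.star_one])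
    (fun hx => MatrixOrdering.orderUnit_of_one _ (fun _ hv => maxOrdering_orderUnit S T hv) hx)
    (fun hx hx' => maxOrdering_proper S T hx hx')

end OperatorSystem

end Constructions

end OpSys

end

/-! ### Quadratic forms of amplified matrix-valued maps. -/

namespace OpSys

set_option linter.unusedSectionVars false

variable {V W U : Type*} [AddCommGroup V] [Module ℂ V] [StarAddMonoid V] [StarModule ℂ V]
  [AddCommGroup W] [Module ℂ W] [StarAddMonoid W] [StarModule ℂ W]
  [AddCommGroup U] [Module ℂ U] [StarAddMonoid U] [StarModule ℂ U]

/-! The two equivalences are independent.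

(1) and (2): up to an ε-perturbation, an element of a cone of `OMAX^p(S)` is a sum of conjugates `β
x β*` with `x ∈ M_p(S)^+`, and similarly for `OMAX^q(T)`. By bilinearity, the level `r` cone of the
maximal tensor product therefore consists, up to perturbation, of sums of matrices `α (x ⊗ y) α*`
with `x ∈ M_p(S)^+` and `y ∈ M_q(T)^+`, and `(p, q, r)`-positivity says exactly that their images
are positive (`IsPQRPositive.congrBy_mem`). The perturbations enter the image polynomially and are
removed by `mem_pos_of_forall_quadratic`. Conversely, `x` and `y` already lie in the `OMAX` cones at
levels `p` and `q`, so `α (x ⊗ y) α*` is an admissible input for (2).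

(2) and (3): this holds for every linear map between operator systems. The quadratic form of the
`n`-th amplification of an `M_r`-valued map, at a vector of `ℂ^n ⊗ ℂ^r`, sees its argument only
through a matrix `u* x u` of size `r` (`dotProduct_comp_map`); hence `r`-positivity gives complete
positivity into `OMIN^r(R)`. The converse needs `M_r(OMIN^r(R))^+ ⊆ M_r(R)^+`
(`mem_pos_of_mem_OMIN`). A hermitian `y` outside `M_r(R)^+` is separated from that cone by a state
`s` of the operator system `M_r(R)`. Such a state corresponds to a completely positive map `R →
M_r`, which becomes unital after adding a small multiple of a state and conjugating. Testing `y` on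
the resulting map and letting the perturbation vanish gives `0 ≤ s y`, a contradiction. -/

/-- In the order of `ℂ`, `0 ≤ z` includes that `z` is real, and a complex quadratic form with real
values comes from a hermitian matrix; hence no separate hermiticity hypothesis. -/
theorem posSemidef_of_dotProduct_nonneg {ι : Type*} [Fintype ι] {A : Matrix ι ι ℂ}
    (h : ∀ u : ι → ℂ, 0 ≤ star u ⬝ᵥ A *ᵥ u) : A.PosSemidef := by
  classical
  rw [← Matrix.isPositive_toEuclideanLin_iff, LinearMap.isPositive_iff_complex]
  intro x
  have hx := h x.ofLp
  -- The inner product is conjugate-linear in its first slot, so a conjugate appears; it is harmless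
  -- because the value is real.
  have e : inner ℂ (Matrix.toEuclideanLin A x) x = star (star x.ofLp ⬝ᵥ A *ᵥ x.ofLp) := by
    rw [EuclideanSpace.inner_eq_star_dotProduct, Matrix.ofLp_toLpLin,
      Matrix.toLin'_apply, Matrix.star_dotProduct, star_star, dotProduct_comm]
  rw [e, (IsSelfAdjoint.of_nonneg hx).star_eq]
  obtain ⟨h1, h2⟩ := Complex.nonneg_iff.1 hx
  exact ⟨Complex.ext (by simp) (by simpa using h2), h1⟩

theorem congrBy_one {n : Type*} [Fintype n] [DecidableEq n] (x : Matrix n n V) :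
    congrBy (1 : Matrix n n ℂ) x = x := by
  ext i j; simp [congrBy, Matrix.one_apply, apply_ite (starRingEnd ℂ)]

/-- Reindexing along `f` is conjugation by a 0-1 matrix, whether or not `f` is injective. -/
theorem MatrixOrdering.submatrix_mem (D : MatrixOrdering V) {m n : ℕ}
    {x : Matrix (Fin n) (Fin n) V} (hx : x ∈ D.pos n) (f : Fin m → Fin n) :
    x.submatrix f f ∈ D.pos m := by
  convert D.congr_mem (Matrix.of fun i k => if f i = k then 1 else 0) hx using 1
  ext i j
  simp [congrBy, apply_ite (starRingEnd ℂ)]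

/-- Reading `u` as an `n × k` matrix replaces the level `n` matrix `x` by the level `k` matrix `u* x
u`. This reduction of level is what makes positivity at level `k` decisive for maps into `M_k`. -/
theorem dotProduct_comp_map {n k : ℕ} (g : V →ₗ[ℂ] Matrix (Fin k) (Fin k) ℂ)
    (x : Matrix (Fin n) (Fin n) V) (u : Fin n × Fin k → ℂ) :
    star u ⬝ᵥ Matrix.comp (Fin n) (Fin n) (Fin k) (Fin k) ℂ (x.map g) *ᵥ u =
      ∑ a, ∑ b, g (congrBy (Matrix.of fun a i => star (u (i, a))) x a b) a b := by
  simp only [dotProduct, Matrix.mulVec, Matrix.comp_apply, Matrix.map_apply, congrBy,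
    Matrix.of_apply, map_sum, map_smul, Matrix.sum_apply, Matrix.smul_apply, Pi.star_apply,
    star_star, smul_eq_mul, Fintype.sum_prod_type, Finset.mul_sum]
  rw [Finset.sum_comm]
  refine Finset.sum_congr rfl fun a _ => ?_
  rw [Finset.sum_comm' (t' := Finset.univ) (s' := fun _ => Finset.univ) (by simp)]
  calc _ = ∑ j, ∑ i, ∑ b, star (u (i, a)) * (g (x i j) a b * u (j, b)) := rfl
    _ = ∑ i, ∑ j, ∑ b, star (u (i, a)) * (g (x i j) a b * u (j, b)) := Finset.sum_comm
    _ = ∑ i, ∑ b, ∑ j, star (u (i, a)) * (g (x i j) a b * u (j, b)) :=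
        Finset.sum_congr rfl fun i _ => Finset.sum_comm
    _ = ∑ b, ∑ i, ∑ j, star (u (i, a)) * (g (x i j) a b * u (j, b)) := Finset.sum_comm
    _ = _ := by
        refine Finset.sum_congr rfl fun b _ => Finset.sum_congr rfl fun i _ =>
          Finset.sum_congr rfl fun j _ => by ring

/-- The sum is the quadratic form at the vector `∑ e_a ⊗ e_a`, for which the matrix `u` of
`dotProduct_comp_map` is the identity. -/
theorem sum_diag_nonneg {k : ℕ} {g : V →ₗ[ℂ] Matrix (Fin k) (Fin k) ℂ}
    {x : Matrix (Fin k) (Fin k) V}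
    (h : (Matrix.comp (Fin k) (Fin k) (Fin k) (Fin k) ℂ (x.map g)).PosSemidef) :
    0 ≤ ∑ a, ∑ b, g (x a b) a b := by
  have h1 := h.dotProduct_mulVec_nonneg fun s => if s.2 = s.1 then 1 else 0
  rw [dotProduct_comp_map] at h1
  have e : (Matrix.of fun a i => star ((fun s : Fin k × Fin k => if s.2 = s.1 then (1 : ℂ) else 0)
      (i, a))) = (1 : Matrix (Fin k) (Fin k) ℂ) := by
    ext a i; simp [Matrix.one_apply, apply_ite (starRingEnd ℂ)]
  rwa [e, congrBy_one] at h1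

namespace OperatorSystem

/-- For a unital completely positive `ψ`, the quadratic form of `ψ ∘ f` at `u` depends only on `f`
applied entrywise to `u* x u`, which is a positive matrix of size `r`; so only `r`-positivity of `f`
is used. -/
theorem isCompletelyPositive_OMIN_of_isKPositive {S : OperatorSystem V} {R : OperatorSystem U}
    {r : ℕ} [NeZero r] {f : V →ₗ[ℂ] U} (hf : S.IsKPositive R r f) :
    S.IsCompletelyPositive (R.OMIN r) f := by
  intro n x hx ψ hψ
  refine posSemidef_of_dotProduct_nonneg fun u => ?_
  rw [dotProduct_comp_map, ← congrBy_map]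
  exact sum_diag_nonneg (hψ.2 r _ (hf _ (S.congr_mem _ hx)))

/-! ### The operator system of `r × r` matrices over an operator system. -/

/-- The matrix over `V` obtained from a matrix over `M_r(V)` by erasing the inner brackets. -/
def flatten {n r : ℕ} (x : Matrix (Fin n) (Fin n) (Matrix (Fin r) (Fin r) V)) :
    Matrix (Fin (n * r)) (Fin (n * r)) V :=
  (Matrix.comp (Fin n) (Fin n) (Fin r) (Fin r) V x).submatrix
    finProdFinEquiv.symm finProdFinEquiv.symm

theorem flatten_apply {n r : ℕ} (x : Matrix (Fin n) (Fin n) (Matrix (Fin r) (Fin r) V))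
    (i j : Fin n) (a b : Fin r) :
    flatten x (finProdFinEquiv (i, a)) (finProdFinEquiv (j, b)) = x i j a b := by
  simp [flatten]

theorem flatten_ext {n r : ℕ} {x : Matrix (Fin n) (Fin n) (Matrix (Fin r) (Fin r) V)}
    {y : Matrix (Fin (n * r)) (Fin (n * r)) V}
    (h : ∀ i j a b, x i j a b = y (finProdFinEquiv (i, a)) (finProdFinEquiv (j, b))) :
    flatten x = y := by
  ext s t
  obtain ⟨⟨i, a⟩, rfl⟩ := finProdFinEquiv.surjective s
  obtain ⟨⟨j, b⟩, rfl⟩ := finProdFinEquiv.surjective t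
  rw [flatten_apply, h]

theorem flatten_unitMatrix (n r : ℕ) (e : V) :
    flatten (unitMatrix n (unitMatrix r e)) = unitMatrix (n * r) e := by
  refine flatten_ext fun i j a b => ?_
  by_cases h : i = j <;> by_cases h' : a = b <;>
    simp [unitMatrix, h, h']

theorem isHermitian_flatten {n r : ℕ}
    {x : Matrix (Fin n) (Fin n) (Matrix (Fin r) (Fin r) V)} :
    (flatten x).IsHermitian ↔ x.IsHermitian := by
  constructor
  · intro h
    ext i j a b
    have := congrFun (congrFun h (finProdFinEquiv (i, a))) (finProdFinEquiv (j, b))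
    rw [Matrix.conjTranspose_apply, flatten_apply, flatten_apply] at this
    exact this
  · intro h
    refine (flatten_ext fun i j a b => ?_).symm
    rw [Matrix.conjTranspose_apply, flatten_apply]
    exact (congrFun (congrFun (congrFun (congrFun h i) j) a) b).symm

/-- The operator system `M_r(S)`. -/
def amplification (S : OperatorSystem V) (r : ℕ) : OperatorSystem (Matrix (Fin r) (Fin r) V) where
  pos n := {x | flatten x ∈ S.pos (n * r)}
  isHermitian hx := isHermitian_flatten.1 (S.isHermitian hx)
  zero_mem n := S.zero_mem (n * r)
  add_mem hx hy := S.add_mem hx hy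
  congr_mem {m n} α x hx := by
    -- This scalar matrix is `α ⊗ I_r` in flattened indices: conjugating the flattened matrix by it
    -- conjugates the blocks by `α`.
    have h := S.congr_mem (Matrix.of fun s t =>
      α (finProdFinEquiv.symm s).1 (finProdFinEquiv.symm t).1 *
        if (finProdFinEquiv.symm s).2 = (finProdFinEquiv.symm t).2 then 1 else 0) hx
    have e : flatten (congrBy α x) = _ := flatten_ext (y := congrBy (Matrix.of fun s t =>
      α (finProdFinEquiv.symm s).1 (finProdFinEquiv.symm t).1 *
        if (finProdFinEquiv.symm s).2 = (finProdFinEquiv.symm t).2 then 1 else 0) (flatten x))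
      fun i j a b => by
        simp only [congrBy, Matrix.of_apply, Matrix.sum_apply, Matrix.smul_apply,
          Equiv.symm_apply_apply]
        simp only [← finProdFinEquiv.sum_comp, Fintype.sum_prod_type, Equiv.symm_apply_apply,
          flatten_apply, mul_ite, mul_one, mul_zero, ite_mul, zero_mul, apply_ite star, star_zero,
          ite_smul, zero_smul]
        simp
    change flatten (congrBy α x) ∈ S.pos (m * r)
    rw [e]
    exact h
  one := unitMatrix r S.one
  star_one := isHermitian_unitMatrix r S.star_one
  proper {n x} hx hx' := by
    have h := S.proper hx hx'
    ext i j a b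
    rw [← flatten_apply x, h]; rfl
  orderUnit {n x} hx := by
    obtain ⟨ρ, hρ, h⟩ := S.orderUnit (isHermitian_flatten.2 hx)
    refine ⟨ρ, hρ, ?_⟩
    rw [← flatten_unitMatrix] at h
    exact h
  archimedean {n x} hx := by
    refine S.archimedean fun ε hε => ?_
    rw [← flatten_unitMatrix]
    exact hx ε hε

/-- This is what lets `exists_state_neg`, a statement about level one, separate points from
`M_r(S)^+`. The indices `Fin (1 * r)` and `Fin r` are matched by a reindexing in each direction. -/
theorem mat1_mem_amplification {S : OperatorSystem V} {r : ℕ} {y : Matrix (Fin r) (Fin r) V} :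
    mat1 y ∈ (S.amplification r).pos 1 ↔ y ∈ S.pos r := by
  constructor
  · intro h
    convert S.submatrix_mem h fun a => finProdFinEquiv (0, a) using 1
    ext a b
    rw [Matrix.submatrix_apply, flatten_apply]
    rfl
  · intro h
    have h2 := S.submatrix_mem h fun s : Fin (1 * r) => (finProdFinEquiv.symm s).2
    exact h2

/-! ### Functionals on `M_k(V)`, completely positive maps into `M_k`, and level `k` of `OMIN^k`. -/

/-- The map `v ↦ [s(E_{ab} ⊗ v)]_{a,b}` associated with a functional `s` on `M_k(V)`. -/
def blockMap {k : ℕ} (s : Matrix (Fin k) (Fin k) V →ₗ[ℂ] ℂ) :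
    V →ₗ[ℂ] Matrix (Fin k) (Fin k) ℂ where
  toFun v := Matrix.of fun a b => s (Matrix.single a b v)
  map_add' v w := by ext a b; simp [Matrix.single_add]
  map_smul' c v := by ext a b; simp [← Matrix.smul_single]

/-- Recovers the functional from its block map: one half of the Choi-type correspondence between
functionals on `M_k(V)` and linear maps `V → M_k`. -/
theorem sum_blockMap_diag {k : ℕ} (s : Matrix (Fin k) (Fin k) V →ₗ[ℂ] ℂ)
    (x : Matrix (Fin k) (Fin k) V) : ∑ a, ∑ b, blockMap s (x a b) a b = s x := by
  conv_rhs => rw [Matrix.matrix_eq_sum_single x]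
  simp [blockMap, map_sum]

theorem nonneg_of_isState_amplification {S : OperatorSystem V} {k : ℕ}
    {s : Matrix (Fin k) (Fin k) V →ₗ[ℂ] ℂ} (hs : (S.amplification k).IsState s)
    {x : Matrix (Fin k) (Fin k) V} (hx : x ∈ S.pos k) : 0 ≤ s x :=
  hs.2 x (mat1_mem_amplification.2 hx)

/-- The quadratic form at `u` equals `s (u* x u)`, so a state yields a completely positive map,
though not in general a unital one. -/
theorem posSemidef_blockMap {S : OperatorSystem V} {k : ℕ}
    {s : Matrix (Fin k) (Fin k) V →ₗ[ℂ] ℂ} (hs : (S.amplification k).IsState s) {n : ℕ}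
    {x : Matrix (Fin n) (Fin n) V} (hx : x ∈ S.pos n) :
    (Matrix.comp (Fin n) (Fin n) (Fin k) (Fin k) ℂ (x.map (blockMap s))).PosSemidef := by
  refine posSemidef_of_dotProduct_nonneg fun u => ?_
  rw [dotProduct_comp_map, sum_blockMap_diag]
  exact nonneg_of_isState_amplification hs (S.congr_mem _ hx)

/-- Compose `s` with the diagonal embedding `v ↦ I_k ⊗ v`, which preserves units and positivity. -/
theorem isState_unitMatrix {S : OperatorSystem V} {k : ℕ}
    {s : Matrix (Fin k) (Fin k) V →ₗ[ℂ] ℂ} (hs : (S.amplification k).IsState s) :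
    ∃ f : V →ₗ[ℂ] ℂ, S.IsState f := by
  refine ⟨s ∘ₗ
    { toFun := fun v => unitMatrix k v
      map_add' := fun v w => by ext i j; simp [unitMatrix, Matrix.diagonal_apply]; split_ifs <;> simp
      map_smul' := fun c v => by
        ext i j; simp [unitMatrix, Matrix.diagonal_apply] }, hs.1, fun v hv => ?_⟩
  refine nonneg_of_isState_amplification hs (x := unitMatrix k v) ?_
  rw [unitMatrix_eq_sum]
  exact S.sum_mem _ fun i _ => S.congr_mem _ hv

/-- Write `Q = C* C`; then `C` is invertible and `D = (C⁻¹)*` works. It serves to make a completely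
positive map unital, and invertibility of `D` allows this to be undone. -/
theorem exists_mul_mul_conjTranspose_eq_one {k : ℕ} {Q : Matrix (Fin k) (Fin k) ℂ}
    (hQ : Q.PosDef) : ∃ D : Matrix (Fin k) (Fin k) ℂ, IsUnit D ∧ D * Q * Dᴴ = 1 := by
  obtain ⟨C, hC⟩ : ∃ C : Matrix (Fin k) (Fin k) ℂ, Q = Cᴴ * C := by
    open scoped MatrixOrder in
    exact CStarAlgebra.nonneg_iff_eq_star_mul_self.mp hQ.posSemidef.nonneg
  have hu : IsUnit C := by
    have h := hQ.isUnit
    rw [Matrix.isUnit_iff_isUnit_det, hC, Matrix.det_mul] at h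
    exact (Matrix.isUnit_iff_isUnit_det C).2 (isUnit_of_mul_isUnit_right h)
  have hd := (Matrix.isUnit_iff_isUnit_det C).1 hu
  have h1 : C * C⁻¹ = 1 := Matrix.mul_nonsing_inv C hd
  have h2 : (C⁻¹)ᴴ * Cᴴ = 1 := by
    rw [← Matrix.conjTranspose_mul, h1, Matrix.conjTranspose_one]
  refine ⟨(C⁻¹)ᴴ, IsUnit.of_mul_eq_one _ h2, ?_⟩
  rw [hC, Matrix.conjTranspose_conjTranspose, ← Matrix.mul_assoc, h2, Matrix.one_mul, h1]

/-- Conjugation of a matrix-valued map by a scalar matrix. -/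
def conjMap {k : ℕ} (D : Matrix (Fin k) (Fin k) ℂ) (ψ : V →ₗ[ℂ] Matrix (Fin k) (Fin k) ℂ) :
    V →ₗ[ℂ] Matrix (Fin k) (Fin k) ℂ where
  toFun v := D * ψ v * Dᴴ
  map_add' v w := by rw [map_add, Matrix.mul_add, Matrix.add_mul]
  map_smul' c v := by rw [map_smul, Matrix.mul_smul, Matrix.smul_mul]; rfl

theorem comp_conjMap {n k : ℕ} (D : Matrix (Fin k) (Fin k) ℂ)
    (ψ : V →ₗ[ℂ] Matrix (Fin k) (Fin k) ℂ) (x : Matrix (Fin n) (Fin n) V) :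
    Matrix.comp (Fin n) (Fin n) (Fin k) (Fin k) ℂ (x.map (conjMap D ψ)) =
      Matrix.kronecker (1 : Matrix (Fin n) (Fin n) ℂ) D *
        Matrix.comp (Fin n) (Fin n) (Fin k) (Fin k) ℂ (x.map ψ) *
        (Matrix.kronecker (1 : Matrix (Fin n) (Fin n) ℂ) D)ᴴ := by
  ext ⟨i, a⟩ ⟨j, b⟩
  simp [conjMap, Matrix.mul_apply, Fintype.sum_prod_type, Matrix.one_apply, ite_mul,
    apply_ite (starRingEnd ℂ), Finset.sum_ite_irrel]

/-- At level `k` the matrices over `S` that are positive under all unital completely positive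
maps `S → M_k` are positive. -/
theorem mem_pos_of_mem_OMIN {S : OperatorSystem V} {k : ℕ} [NeZero k]
    {y : Matrix (Fin k) (Fin k) V} (hy : y ∈ (S.OMIN k).pos k) : y ∈ S.pos k := by
  by_contra hn
  have hh : star y = y := (S.OMIN k).isHermitian hy
  obtain ⟨s, hs, hlt⟩ := (S.amplification k).exists_state_neg hh
    (fun h => hn (mat1_mem_amplification.1 h))
  obtain ⟨f, hf⟩ := isState_unitMatrix hs
  refine hlt.not_ge ?_
  -- Now `s y` is the pairing of `y` with `blockMap s`, so it suffices that `blockMap s` amplifies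
  -- to a positive value on `y`.
  rw [← sum_blockMap_diag]
  apply sum_diag_nonneg
  set g : V →ₗ[ℂ] Matrix (Fin k) (Fin k) ℂ :=
    LinearMap.smulRight f (1 : Matrix (Fin k) (Fin k) ℂ) with hg
  -- `blockMap s S.one` may be singular, which would prevent normalization. Adding `δ • g` makes the
  -- value at the unit at least `δ • 1`; the limit `δ → 0` removes the perturbation.
  refine posSemidef_archimedean (M := Matrix.comp (Fin k) (Fin k) (Fin k) (Fin k) ℂ (y.map g))
    fun δ hδ => ?_
  set ψ := (δ : ℂ) • g + blockMap s with hψ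
  have hψ_comp : ∀ {n : ℕ} (x : Matrix (Fin n) (Fin n) V),
      Matrix.comp (Fin n) (Fin n) (Fin k) (Fin k) ℂ (x.map ψ) =
      (δ : ℂ) • Matrix.comp (Fin n) (Fin n) (Fin k) (Fin k) ℂ (x.map g) +
        Matrix.comp (Fin n) (Fin n) (Fin k) (Fin k) ℂ (x.map (blockMap s)) := by
    intro n x; ext i j; simp [hψ]
  have hδ' : (0 : ℂ) ≤ (δ : ℂ) := by exact_mod_cast hδ.le
  have hψ_pos : ∀ (n : ℕ) (x : Matrix (Fin n) (Fin n) V), x ∈ S.pos n →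
      (Matrix.comp (Fin n) (Fin n) (Fin k) (Fin k) ℂ (x.map ψ)).PosSemidef := by
    intro n x hx
    rw [hψ_comp]
    exact (((hf.isUCP k).2 n x hx).smul hδ').add (posSemidef_blockMap hs hx)
  have hψ_one : (ψ S.one).PosDef := by
    have h1 : (blockMap s S.one).PosSemidef := by
      have := (posSemidef_blockMap hs S.one_mem_one).submatrix fun a : Fin k => ((0 : Fin 1), a)
      convert this using 1
      ext a b; simp [mat1]
    have h2 : ψ S.one = (δ : ℂ) • (1 : Matrix (Fin k) (Fin k) ℂ) + blockMap s S.one := by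
      simp [hψ, hg, hf.1]
    rw [h2]
    exact (Matrix.PosDef.one.smul (by exact_mod_cast hδ)).add_posSemidef h1
  obtain ⟨D, hD, hDQ⟩ := exists_mul_mul_conjTranspose_eq_one hψ_one
  have hucp : S.IsUCP k (conjMap D ψ) := by
    refine ⟨hDQ, fun n x hx => ?_⟩
    rw [comp_conjMap]
    exact (hψ_pos n x hx).mul_mul_conjTranspose_same _
  have h3 := hy _ hucp
  -- Conjugating back by `D⁻¹` carries positivity on `y` from the normalized map to `ψ`.
  have h4 : conjMap D⁻¹ (conjMap D ψ) = ψ := by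
    ext1 v
    have hd := (Matrix.isUnit_iff_isUnit_det D).1 hD
    change D⁻¹ * (D * ψ v * Dᴴ) * (D⁻¹)ᴴ = ψ v
    rw [Matrix.mul_assoc D, Matrix.nonsing_inv_mul_cancel_left _ _ hd, Matrix.mul_assoc,
      ← Matrix.conjTranspose_mul, Matrix.nonsing_inv_mul _ hd, Matrix.conjTranspose_one,
      Matrix.mul_one]
  rw [← hψ_comp, ← h4, comp_conjMap]
  exact h3.mul_mul_conjTranspose_same _

/-- The reverse direction uses complete positivity only at level `r`, where positivity in
`OMIN^r(R)` implies positivity in `R`. -/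
theorem isKPositive_iff_isCompletelyPositive_OMIN {S : OperatorSystem V} {R : OperatorSystem U}
    {r : ℕ} [NeZero r] {f : V →ₗ[ℂ] U} :
    S.IsKPositive R r f ↔ S.IsCompletelyPositive (R.OMIN r) f :=
  ⟨isCompletelyPositive_OMIN_of_isKPositive, fun h x hx => mem_pos_of_mem_OMIN (h r x hx)⟩

/-! ### Removing perturbations, and positivity on the maximal tensor product. -/

/-- A quadratic form of the Archimedean property. -/
theorem mem_pos_of_forall_quadratic {S : OperatorSystem V} {n : ℕ}
    {A B C : Matrix (Fin n) (Fin n) V}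
    (h : ∀ δ : ℝ, 0 < δ → A + (δ : ℂ) • B + ((δ ^ 2 : ℝ) : ℂ) • C ∈ S.pos n) : A ∈ S.pos n := by
  -- Three values of the polynomial suffice for hermiticity: the second difference is `2C`, and the
  -- first difference from 1 to 2 is `B + 3C`.
  have h1 := S.isHermitian (h 1 one_pos)
  have h2 := S.isHermitian (h 2 two_pos)
  have h3 := S.isHermitian (h 3 three_pos)
  have hC : C.IsHermitian := by
    have := isHermitian_real_smul (1 / 2) ((h3.sub h2).sub (h2.sub h1))
    convert this using 1
    push_cast
    module
  have hB : B.IsHermitian := by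
    have := (h2.sub h1).sub (isHermitian_real_smul 3 hC)
    convert this using 1
    push_cast
    module
  obtain ⟨b, hb, hB'⟩ := S.orderUnit hB
  obtain ⟨c, hc, hC'⟩ := S.orderUnit hC
  refine S.archimedean fun ε hε => ?_
  obtain ⟨δ, hδ, hδ1, hδε⟩ : ∃ δ : ℝ, 0 < δ ∧ δ ≤ 1 ∧ δ * (b + c) ≤ ε := by
    refine ⟨min 1 (ε / (b + c)), by positivity, min_le_left _ _, ?_⟩
    calc _ ≤ ε / (b + c) * (b + c) := by gcongr; exact min_le_right _ _
      _ = ε := by field_simp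
  -- Since `δ ≤ 1`, `δ² c ≤ δ c`. With `e` the order unit matrix, `ε e + A` is then the sum of `A +
  -- δB + δ²C`, `(ε - δb - δ²c) e`, `δ (b e - B)` and `δ² (c e - C)`, all positive.
  have hrest : 0 ≤ ε - δ * b - δ ^ 2 * c := by nlinarith [mul_nonneg hδ.le hc.le]
  convert S.add_mem (S.add_mem (h δ hδ) (S.smul_mem (S.unitMatrix_mem n) hrest))
    (S.add_mem (S.smul_mem hB' hδ.le) (S.smul_mem hC' (sq_nonneg δ))) using 1
  push_cast
  module

/-- At level `k` a single block conjugated by the identity is enough. -/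
theorem mem_OMAX_pos {S : OperatorSystem V} {k : ℕ} [NeZero k] {x : Matrix (Fin k) (Fin k) V}
    (hx : x ∈ S.pos k) : x ∈ (S.OMAX k).pos k := by
  intro ε hε
  refine ⟨1, fun _ => (ε : ℂ) • unitMatrix k S.one + x,
    Matrix.of fun i b => if i = b.1 then 1 else 0,
    fun _ => S.add_mem (S.smul_mem (S.unitMatrix_mem k) hε.le) hx, ?_⟩
  rw [congrBy_blockDiagonal, Fin.sum_univ_one]
  exact (congrBy_one _).symm

/-- The unit matrix lies in the cone before Archimedeanization, so adding `ε` times it does not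
leave the cone. -/
theorem mem_maxTensor_pos {S : OperatorSystem V} {T : OperatorSystem W} {n k l : ℕ}
    {P : Matrix (Fin k) (Fin k) V} {Q : Matrix (Fin l) (Fin l) W} (hP : P ∈ S.pos k)
    (hQ : Q ∈ T.pos l) (α : Matrix (Fin n) (Fin k × Fin l) ℂ) :
    congrBy α (Matrix.kroneckerMap (fun a b => a ⊗ₜ[ℂ] b) P Q) ∈ (S.maxTensor T).pos n := by
  intro ε hε
  have h1 : unitMatrix n (S.one ⊗ₜ[ℂ] T.one) ∈ (S.maxOrdering T).pos n := by
    rw [unitMatrix_eq_sum]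
    exact (S.maxOrdering T).sum_mem _ fun i _ => (S.maxOrdering T).congr_mem _
      (tmul_mem_maxOrdering S T S.one_mem_one T.one_mem_one)
  exact (S.maxOrdering T).add_mem ((S.maxOrdering T).smul_mem h1 hε.le) ⟨k, l, P, Q, α, hP, hQ, rfl⟩

theorem map_kroneckerMap_tmul (φ : V →ₗ[ℂ] W →ₗ[ℂ] U) {k l : ℕ} (P : Matrix (Fin k) (Fin k) V)
    (Q : Matrix (Fin l) (Fin l) W) :
    (Matrix.kroneckerMap (fun a b => a ⊗ₜ[ℂ] b) P Q).map (TensorProduct.lift φ) =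
      Matrix.kroneckerMap (fun a b => φ a b) P Q := by
  ext i j; simp

theorem kroneckerMap_congrBy (φ : V →ₗ[ℂ] W →ₗ[ℂ] U) {k l p q : ℕ}
    (α : Matrix (Fin k) (Fin p) ℂ) (β : Matrix (Fin l) (Fin q) ℂ) (x : Matrix (Fin p) (Fin p) V)
    (y : Matrix (Fin q) (Fin q) W) :
    Matrix.kroneckerMap (fun a b => φ a b) (congrBy α x) (congrBy β y) =
      congrBy (Matrix.kronecker α β) (Matrix.kroneckerMap (fun a b => φ a b) x y) := by
  ext ⟨i, j⟩ ⟨i', j'⟩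
  simp only [Matrix.kroneckerMap_apply, congrBy, Matrix.of_apply, map_sum, map_smul,
    LinearMap.sum_apply, LinearMap.smul_apply, Finset.smul_sum, smul_smul, Fintype.sum_prod_type,
    star_mul', Matrix.kronecker]
  calc _ = ∑ c, ∑ d, ∑ a, ∑ b,
        (β j c * star (β j' d) * (α i a * star (α i' b))) • φ (x a b) (y c d) := rfl
    _ = ∑ c, ∑ a, ∑ d, ∑ b,
        (β j c * star (β j' d) * (α i a * star (α i' b))) • φ (x a b) (y c d) :=
        Finset.sum_congr rfl fun c _ => Finset.sum_comm
    _ = ∑ a, ∑ c, ∑ d, ∑ b,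
        (β j c * star (β j' d) * (α i a * star (α i' b))) • φ (x a b) (y c d) :=
        Finset.sum_comm
    _ = ∑ a, ∑ c, ∑ b, ∑ d,
        (β j c * star (β j' d) * (α i a * star (α i' b))) • φ (x a b) (y c d) :=
        Finset.sum_congr rfl fun a _ => Finset.sum_congr rfl fun c _ => Finset.sum_comm
    _ = _ := by
        refine Finset.sum_congr rfl fun a _ => Finset.sum_congr rfl fun c _ =>
          Finset.sum_congr rfl fun b _ => Finset.sum_congr rfl fun d _ => ?_
        congr 1
        ring

/-- Block diagonal matrices split into sums of conjugates of their blocks. By bilinearity each pair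
of blocks contributes a conjugate by a scalar `r × pq` matrix, so the sizes `k` and `l` play no
role. -/
theorem IsPQRPositive.congrBy_mem {S : OperatorSystem V} {T : OperatorSystem W}
    {R : OperatorSystem U} {p q r : ℕ} {φ : V →ₗ[ℂ] W →ₗ[ℂ] U} (h : S.IsPQRPositive T R p q r φ)
    {k l : ℕ} {P : Matrix (Fin k) (Fin k) V} {Q : Matrix (Fin l) (Fin l) W}
    (hP : P ∈ (S.omaxOrdering p).pos k) (hQ : Q ∈ (T.omaxOrdering q).pos l)
    (α : Matrix (Fin r) (Fin k × Fin l) ℂ) :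
    congrBy α (Matrix.kroneckerMap (fun a b => φ a b) P Q) ∈ R.pos r := by
  obtain ⟨m, s, β, hs, rfl⟩ := hP
  obtain ⟨m', t, γ, ht, rfl⟩ := hQ
  rw [congrBy_blockDiagonal, congrBy_blockDiagonal]
  have e : ∀ (x : Fin m → Matrix (Fin k) (Fin k) V) (y : Fin m' → Matrix (Fin l) (Fin l) W),
      Matrix.kroneckerMap (fun a b => φ a b) (∑ i, x i) (∑ j, y j) =
        ∑ i, ∑ j, Matrix.kroneckerMap (fun a b => φ a b) (x i) (y j) := by
    intro x y
    ext a b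
    simp only [Matrix.kroneckerMap_apply, Matrix.sum_apply, map_sum, LinearMap.sum_apply]
    rw [Finset.sum_comm]
  rw [e, congrBy_sum]
  refine R.sum_mem _ fun i _ => ?_
  rw [congrBy_sum]
  refine R.sum_mem _ fun j _ => ?_
  rw [kroneckerMap_congrBy, congrBy_congrBy]
  exact h _ (hs i) _ (ht j) _

/-- Two Archimedeanizations have to be undone: that of the two `OMAX` factors, done in `key`, and
that of the tensor product. -/
theorem IsPQRPositive.isKPositive {S : OperatorSystem V} {T : OperatorSystem W}
    {R : OperatorSystem U} {p q r : ℕ} [NeZero p] [NeZero q] {φ : V →ₗ[ℂ] W →ₗ[ℂ] U}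
    (h : S.IsPQRPositive T R p q r φ) :
    ((S.OMAX p).maxTensor (T.OMAX q)).IsKPositive R r (TensorProduct.lift φ) := by
  have key : ∀ z ∈ ((S.OMAX p).maxOrdering (T.OMAX q)).pos r,
      z.map (TensorProduct.lift φ) ∈ R.pos r := by
    rintro _ ⟨k, l, P, Q, α, hP, hQ, rfl⟩
    rw [congrBy_map, map_kroneckerMap_tmul]
    -- Replacing `P` and `Q` by `P + δ1` and `Q + δ1` puts them in the cones before
    -- Archimedeanization; `B` and `C` are the coefficients of `δ` and `δ²` in the expansion of the
    -- image.
    refine mem_pos_of_forall_quadratic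
      (B := congrBy α (Matrix.kroneckerMap (fun a b => φ a b) (unitMatrix k S.one) Q) +
        congrBy α (Matrix.kroneckerMap (fun a b => φ a b) P (unitMatrix l T.one)))
      (C := congrBy α (Matrix.kroneckerMap (fun a b => φ a b) (unitMatrix k S.one)
        (unitMatrix l T.one))) fun δ hδ => ?_
    convert h.congrBy_mem (hP δ hδ) (hQ δ hδ) α using 1
    rw [← congrBy_add, ← congrBy_smul, ← congrBy_smul, ← congrBy_add, ← congrBy_add]
    congr 1
    ext a b
    simp only [Matrix.add_apply, Matrix.smul_apply, Matrix.kroneckerMap_apply, map_add, map_smul,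
      LinearMap.add_apply, LinearMap.smul_apply]
    push_cast
    module
  intro z hz
  -- The perturbation of the tensor is linear in `δ`, hence `C = 0`.
  refine mem_pos_of_forall_quadratic
    (B := (unitMatrix r (S.one ⊗ₜ[ℂ] T.one)).map (TensorProduct.lift φ)) (C := 0) fun δ hδ => ?_
  convert key _ (hz δ hδ) using 1
  ext i j
  simp only [Matrix.add_apply, Matrix.smul_apply, Matrix.map_apply, Matrix.zero_apply, map_add,
    map_smul]
  rw [smul_zero, add_zero, add_comm]
  rfl

/-- The matrix `α (x ⊗ y) α*` is itself positive at level `r` of the maximal tensor product, because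
`x` and `y` stay positive in `OMAX^p(S)` and `OMAX^q(T)`. -/
theorem isPQRPositive_of_isKPositive {S : OperatorSystem V} {T : OperatorSystem W}
    {R : OperatorSystem U} {p q r : ℕ} [NeZero p] [NeZero q] {φ : V →ₗ[ℂ] W →ₗ[ℂ] U}
    (h : ((S.OMAX p).maxTensor (T.OMAX q)).IsKPositive R r (TensorProduct.lift φ)) :
    S.IsPQRPositive T R p q r φ := by
  intro x hx y hy α
  have := h _ (mem_maxTensor_pos (mem_OMAX_pos hx) (mem_OMAX_pos hy) α)
  rwa [congrBy_map, map_kroneckerMap_tmul] at this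

end OperatorSystem

end OpSys

/-- For operator systems `S`, `T`, `R`, a bilinear map `φ : S × T → R` and `p, q, r ≥ 1`, the
following are equivalent: `φ` is `(p, q, r)`-positive; its linearization
`OMAX^p(S) ⊗_max OMAX^q(T) → R` is `r`-positive; its linearization
`OMAX^p(S) ⊗_max OMAX^q(T) → OMIN^r(R)` is completely positive. -/
theorem mainTheorem3 {V W U : Type*}
    [AddCommGroup V] [Module ℂ V] [StarAddMonoid V] [StarModule ℂ V]
    [AddCommGroup W] [Module ℂ W] [StarAddMonoid W] [StarModule ℂ W]
    [AddCommGroup U] [Module ℂ U] [StarAddMonoid U] [StarModule ℂ U]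
    (S : OpSys.OperatorSystem V) (T : OpSys.OperatorSystem W) (R : OpSys.OperatorSystem U)
    (φ : V →ₗ[ℂ] W →ₗ[ℂ] U) (p q r : ℕ) [NeZero p] [NeZero q] [NeZero r] :
    (S.IsPQRPositive T R p q r φ ↔
      ((S.OMAX p).maxTensor (T.OMAX q)).IsKPositive R r (TensorProduct.lift φ)) ∧
    (((S.OMAX p).maxTensor (T.OMAX q)).IsKPositive R r (TensorProduct.lift φ) ↔
      ((S.OMAX p).maxTensor (T.OMAX q)).IsCompletelyPositive (R.OMIN r)
        (TensorProduct.lift φ)) := by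
  exact ⟨⟨OpSys.OperatorSystem.IsPQRPositive.isKPositive,
    OpSys.OperatorSystem.isPQRPositive_of_isKPositive⟩,
    OpSys.OperatorSystem.isKPositive_iff_isCompletelyPositive_OMIN⟩
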